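/- **Setting.** Let $\mathcal M=(\mathcal S,\mathcal A,\mathcal P,c,\gamma)$ be a finite Markov decision process with costs $0\le c(s,a)\le 1$ and discount factor $\gamma\in(0,1)$. For a stationary randomized policy $\pi$ let $V^\pi(s)=\mathbb E[\sum_{t\ge 0}\gamma^t c(S_t,A_t)\mid S_0=s]$, with $A_t\sim\pi(\cdot|S_t)$ and $S_{t+1}\sim\mathcal P(\cdot|S_t,A_t)$. For an arbitrary distribution $\vartheta$ on $\mathcal S$ let $f(\pi)=\mathbb E_{s\sim\vartheta}V^\pi(s)$. Let $\pi^*$ be an optimal policy, that is, $V^{\pi^*}(s)\le V^{\pi}(s)$ for all $s$ and $\pi$. **Algorithm.** Stochastic policy mirror descent (SPMD) with the KL divergence and constant stepsize $\eta$ starts from the uniform policy $\pi_0$. For $t=0,\dots,k-1$ and every $s\in\mathcal S$ it sets $$\pi_{t+1}(\cdot|s)=\operatorname*{argmin}_{p\in\Delta_{\mathcal A}}\ \eta\,\langle Q^{\pi_t,\xi_t}(s,\cdot),p\rangle+\sum_{a}p(a)\log\frac{p(a)}{\pi_t(a|s)} .$$ The sample $\xi_t$ is generated by following $\pi_t$ from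 initial state(s) that are arbitrary and may depend on the past; all actions, including the first, are drawn from $\pi_t$. For a trajectory $(S_0,A_0),(S_1,A_1),\dots$ and $n\ge1$ let $\tau(s)$ be the first $t\le n-1$ with $S_t=s$, and $\tau(s)=n$ if there is none. The estimate $Q^{\pi,\xi}$ is one of the following two. * VBE-I: $\xi=(\xi_V,\xi_Q)$, where $\xi_V$ has $n$ state-action pairs, $\xi_Q$ has $n+1$ (the action of the last pair is not used), and the two trajectories are independent given the past and their initial states. Let $\hat V(s')=\sum_{t=\tau(s')}^{n-1}\gamma^{t-\tau(s')}c(S_t,A_t)$, computed on $\xi_V$. Then, with $\tau$ and $(S_t,A_t)$ taken from $\xi_Q$, $$Q^{\pi,\xi}(s,a)=\frac{\mathbf 1\{a=A_{\tau(s)}\}}{\pi(a|s)}\bigl[c(s,a)+\gamma\hat V(S_{\tau(s)+1})\bigr]\ \text{ if }\tau(s)\le n-1,\qquad Q^{\pi,\xi}(s,a)=0\ \text{ if }\tau(s)=n.$$ * VBE-II: $\xi$ is a single trajectory with $n+1$ state-action pairs, and $$Q^{\pi,\xi}(s,a)=\frac{\mathbf 1\{a=A_{\tau(s)}\}}{\pi(a|s)}\sum_{t=\tau(s)}^{n-1}\gamma^{t-\tau(s)}c(S_t,A_t)\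 \text{ if }\tau(s)\le n-1,\qquad Q^{\pi,\xi}(s,a)=0\ \text{ if }\tau(s)=n.$$ **Mixing assumption.** There are $C>0$, $\rho\in(0,1)$ and $\underline\nu>0$ such that almost surely, for every $i\le k$, the state chain of $\pi_i$ has a stationary distribution $\nu^{\pi_i}$ with $\min_s\nu^{\pi_i}(s)\ge\underline\nu$ and $$\sum_s|\mathbb P(S_t=s\mid S_0=s_0)-\nu^{\pi_i}(s)|\le C\rho^{t+1}\quad\text{for all } s_0\in\mathcal S,\ t\ge 0 .$$ Put $t_{\mathrm{mix}}=\max\{1,\lceil\log_\rho(\underline\nu/(2C))\rceil\}$. **Theorem.** (1) For all $k,n\ge1$, SPMD with VBE-I or VBE-II and stepsize $\eta=\sqrt{\frac{2(1-\gamma)^2\log|\mathcal A|}{k|\mathcal A|}}$ satisfies, under the mixing assumption and with $R$ uniform on $\{0,\dots,k-1\}$ and independent of the samples, $$\mathbb E[f(\pi_R)-f(\pi^*)]\le\sqrt{\frac{2|\mathcal A|\log|\mathcal A|}{k(1-\gamma)^4}}+\frac{\varepsilon_n}{1-\gamma},$$ $$\varepsilon_n=\frac{4(n+1)}{1-\gamma}\Bigl[\gamma^{n-1}+\Bigl(1-\frac{\underline\nu}{2t_{\mathrm{mix}}}\Bigr)^{n-1}\Bigr]+\frac{8(1-\underline\nu/2)^{\lceil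 n/t_{\mathrm{mix}}\rceil}}{1-\gamma}.$$ (2) There is an absolute constant $K>0$ with the following property. Let $|\mathcal A|\ge2$, $0<\epsilon\le\frac1{2(1-\gamma)}$, $C>0$, $\rho\in(0,1)$ and $\underline\nu\in(0,1]$. Then there are $k,n\ge1$, depending only on $|\mathcal A|,\gamma,\epsilon,C,\rho,\underline\nu$, such that SPMD as in (1) satisfies $\mathbb E[f(\pi_R)-f(\pi^*)]\le\epsilon$ for every $\vartheta$ whenever the mixing assumption holds, and the total number of sampled state-action pairs in the $k$ iterations is at most $$K\cdot\frac{|\mathcal A|\log|\mathcal A|}{\epsilon^2(1-\gamma)^4}\Bigl(\frac1{1-\gamma}+\frac{t_{\mathrm{mix}}}{\underline\nu}\Bigr)\log\Bigl(\frac1{(1-\gamma)\epsilon}\Bigr)\cdot\log\Bigl(\frac1{1-\gamma}+\frac{t_{\mathrm{mix}}}{\underline\nu}\Bigr).$$ -/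

import Mathlib

open MeasureTheory ProbabilityTheory

universe u v w

/-- A finite discounted Markov decision process with costs in `[0, 1]`;
`P s a s'` is the probability of moving from `s` to `s'` under action `a`. -/
structure MDP (S : Type*) (A : Type*) [Fintype S] where
  P : S → A → S → ℝ
  P_mem : ∀ s a, P s a ∈ stdSimplex ℝ S
  c : S → A → ℝ
  c_nonneg : ∀ s a, 0 ≤ c s a
  c_le_one : ∀ s a, c s a ≤ 1
  γ : ℝ
  γ_pos : 0 < γ
  γ_lt_one : γ < 1

/-- `π` is a randomized stationary policy: `π s` is a probability vector on the actions. -/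
def IsPolicy {S A : Type*} [Fintype A] (π : S → A → ℝ) : Prop :=
  ∀ s, π s ∈ stdSimplex ℝ A

/-- The Kullback-Leibler divergence `∑ₐ p(a) log (p(a) / q(a))`, with `0 log 0 = 0`. -/
noncomputable def klDivVec {A : Type*} [Fintype A] (p q : A → ℝ) : ℝ :=
  ∑ a, p a * Real.log (p a / q a)

namespace MDP

variable {S A : Type*} [Fintype S] [Fintype A]

/-- One-step transition probability of the state chain of the policy `π`, from `s` to `s'`. -/
noncomputable def stateKernel (M : MDP S A) (π : S → A → ℝ) (s s' : S) : ℝ :=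
  ∑ a, π s a * M.P s a s'

open Classical in
/-- `M.stateDist π s₀ t s` is the probability that `S_t = s` given `S_0 = s₀`, under `π`. -/
noncomputable def stateDist (M : MDP S A) (π : S → A → ℝ) (s₀ : S) : ℕ → S → ℝ
  | 0 => fun s => if s = s₀ then 1 else 0
  | t + 1 => fun s => ∑ s', M.stateDist π s₀ t s' * M.stateKernel π s' s

/-- The value function: `∑ₜ γᵗ E[c(S_t, A_t)]` for the chain started at `s`. -/
noncomputable def value (M : MDP S A) (π : S → A → ℝ) (s : S) : ℝ :=
  ∑' t : ℕ, M.γ ^ t * ∑ s', M.stateDist π s t s' * ∑ a, π s' a * M.c s' a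

/-- The objective: the value averaged over the distribution `θ` of the state. -/
noncomputable def objective (M : MDP S A) (θ : S → ℝ) (π : S → A → ℝ) : ℝ :=
  ∑ s, θ s * M.value π s

/-- `πstar` is an optimal policy. -/
def IsOptimal (M : MDP S A) (πstar : S → A → ℝ) : Prop :=
  IsPolicy πstar ∧ ∀ π : S → A → ℝ, IsPolicy π → ∀ s, M.value πstar s ≤ M.value π s

/-- The state chain of `π` has a stationary distribution `ν` with all entries at least `νlow`,
and from every initial state it converges to `ν` geometrically with constants `C`, `ρ`. -/
def Mixes (M : MDP S A) (π : S → A → ℝ) (C ρ νlow : ℝ) : Prop :=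
  ∃ ν : S → ℝ, ν ∈ stdSimplex ℝ S ∧
    (∀ s, ν s = ∑ s', ν s' * M.stateKernel π s' s) ∧
    (∀ s₀ : S, ∀ t : ℕ, ∑ s, |M.stateDist π s₀ t s - ν s| ≤ C * ρ ^ (t + 1)) ∧
    ∀ s, νlow ≤ ν s

/-- The probability, given its first state, of the trajectory `z = (Z_0, ..., Z_{m-1})` of
state-action pairs generated by following `π`. -/
noncomputable def trajProb (M : MDP S A) {m : ℕ} (π : S → A → ℝ) (z : Fin m → S × A) : ℝ :=
  (∏ i : Fin m, π (z i).1 (z i).2) *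
    ∏ i : Fin m, if h : i.1 + 1 < m then M.P (z i).1 (z i).2 (z ⟨i.1 + 1, h⟩).1 else 1

end MDP

/-- Two trajectories have the same first state. -/
def SameStart {S A : Type*} {m : ℕ} (z z' : Fin m → S × A) : Prop :=
  ∀ i : Fin m, i.1 = 0 → (z i).1 = (z' i).1

/-- The first time `t ≤ n - 1` at which the trajectory `(Z_0, ..., Z_{n-1})` is in state `s`,
and `n` if there is none. -/
noncomputable def hitTime {S A : Type*} {n : ℕ} (z : Fin n → S × A) (s : S) : ℕ :=
  sInf ({t | ∃ h : t < n, (z ⟨t, h⟩).1 = s} ∪ {n})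

/-- The on-policy Monte Carlo value estimate `∑_{t=τ(s)}^{n-1} γ^{t-τ(s)} c(S_t, A_t)`,
which is the empty sum if `s` is not visited. -/
noncomputable def omcValue {S A : Type*} [Fintype S] (M : MDP S A) {n : ℕ}
    (z : Fin n → S × A) (s : S) : ℝ :=
  ∑ t : Fin n, if hitTime z s ≤ t.1 then M.γ ^ (t.1 - hitTime z s) * M.c (z t).1 (z t).2 else 0

open Classical in
/-- The VBE-I estimate from `ξV = (Z_0, ..., Z_{n-1})` and a second trajectory
`ξQ = (Z_0, ..., Z_{n-1}, Z_n)`, of whose last pair only the state is read. -/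
noncomputable def vbeIEstimate {S A : Type*} [Fintype S] (M : MDP S A) {n : ℕ} (π : S → A → ℝ)
    (ξV : Fin n → S × A) (ξQ : Fin (n + 1) → S × A) (s : S) (a : A) : ℝ :=
  let τ := hitTime (fun i : Fin n => ξQ i.castSucc) s
  if h : τ < n then
    (if a = (ξQ ⟨τ, by omega⟩).2 then 1 else 0) / π s a *
      (M.c s a + M.γ * omcValue M ξV (ξQ ⟨τ + 1, by omega⟩).1)
  else 0

open Classical in
/-- The VBE-II estimate from a single trajectory `ξ = (Z_0, ..., Z_n)`. -/
noncomputable def vbeIIEstimate {S A : Type*} [Fintype S] (M : MDP S A) {n : ℕ} (π : S → A → ℝ)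
    (ξ : Fin (n + 1) → S × A) (s : S) (a : A) : ℝ :=
  let τ := hitTime (fun i : Fin n => ξ i.castSucc) s
  if h : τ < n then
    (if a = (ξ ⟨τ, by omega⟩).2 then 1 else 0) / π s a *
      omcValue M (fun i : Fin n => ξ i.castSucc) s
  else 0

/-- The data of an online policy evaluation operator: the type of the random sample used in one
iteration, whether two samples have the same initial state(s), the probability of a sample under
a policy given its initial state(s), the estimate of the Q-function computed from the sample, and
the number of state-action pairs in a sample. -/
structure EvalOp (S : Type u) (A : Type v) where
  Sample : Type (max u v)
  sameStart : Sample → Sample → Prop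
  prob : (S → A → ℝ) → Sample → ℝ
  estimate : (S → A → ℝ) → Sample → S → A → ℝ
  size : ℕ

/-- Samples are discrete. -/
instance {S A : Type*} (E : EvalOp S A) : MeasurableSpace E.Sample := ⊤

/-- VBE-I with trajectory length parameter `n`: two trajectories, which given their initial states
are independent. -/
noncomputable def vbeI {S A : Type*} [Fintype S] [Fintype A] (M : MDP S A) (n : ℕ) :
    EvalOp S A where
  Sample := (Fin n → S × A) × (Fin (n + 1) → S × A)
  sameStart ξ ξ' := SameStart ξ.1 ξ'.1 ∧ SameStart ξ.2 ξ'.2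
  prob π ξ := M.trajProb π ξ.1 * M.trajProb π ξ.2
  estimate π ξ := vbeIEstimate M π ξ.1 ξ.2
  size := n + (n + 1)

/-- VBE-II with trajectory length parameter `n`: a single trajectory. -/
noncomputable def vbeII {S A : Type*} [Fintype S] [Fintype A] (M : MDP S A) (n : ℕ) :
    EvalOp S A where
  Sample := Fin (n + 1) → S × A
  sameStart := SameStart
  prob π ξ := M.trajProb π ξ
  estimate π ξ := vbeIIEstimate M π ξ
  size := n + 1

/-- The two variants of value-based estimation. -/
inductive VBEVariant where
  | I
  | II

/-- The value-based estimation operator of the given variant. -/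
noncomputable def vbe {S A : Type*} [Fintype S] [Fintype A] (v : VBEVariant) (M : MDP S A)
    (n : ℕ) : EvalOp S A :=
  match v with
  | VBEVariant.I => vbeI M n
  | VBEVariant.II => vbeII M n

/-- `k` iterations of stochastic policy mirror descent with the KL divergence, the constant
stepsize `η`, the uniform initial policy and the evaluation operator `E`, on the probability
space `(Ω, μ)`. Here `ξ t` is the sample of iteration `t`, `π t` is the `t`-th policy, and `R` is
the random index of the output policy. The initial states of the trajectories in each
iteration are arbitrary, and may depend on the past. -/
structure IsSPMDRun {S A Ω : Type*} [Fintype S] [Fintype A] [MeasurableSpace Ω]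
    (E : EvalOp S A) (η : ℝ) (k : ℕ) (μ : Measure Ω)
    (ξ : ℕ → Ω → E.Sample) (π : ℕ → Ω → S → A → ℝ) (R : Ω → Fin k) : Prop where
  measurable_sample : ∀ t < k, Measurable (ξ t)
  /-- The initial policy is uniform. -/
  init : ∀ ω s a, π 0 ω s a = 1 / (Fintype.card A : ℝ)
  /-- The mirror descent step: `π_{t+1}(·|s)` minimizes `η⟨Q^{π_t,ξ_t}(s,·), p⟩ + D(p, π_t(·|s))`
  over the probability simplex. -/
  step_mem : ∀ t < k, ∀ ω, IsPolicy (π (t + 1) ω)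
  step_min : ∀ t < k, ∀ ω s,
    IsMinOn (fun p : A → ℝ =>
      η * ∑ a, E.estimate (π t ω) (ξ t ω) s a * p a + klDivVec p (π t ω s))
      (stdSimplex ℝ A) (π (t + 1) ω s)
  /-- Given the past samples and the initial state(s) of the new one, the sample of
  iteration `t` is generated by following the policy `π t`. -/
  law : ∀ t < k, ∀ (x : Fin t → E.Sample) (y : E.Sample),
    μ.real {ω | (∀ i : Fin t, ξ i ω = x i) ∧ ξ t ω = y} =
      ∫ ω in {ω | (∀ i : Fin t, ξ i ω = x i) ∧ E.sameStart (ξ t ω) y}, E.prob (π t ω) y ∂μ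
  /-- `R` is uniform on `{0, ..., k-1}` and independent of the samples. -/
  measurable_index : Measurable R
  index_uniform : ∀ i : Fin k, μ.real {ω | R ω = i} = 1 / (k : ℝ)
  index_indep : IndepFun R (fun ω (t : Fin k) => ξ t ω) μ

/-- The stepsize. -/
noncomputable def spmdStep (cardA : ℕ) (γ : ℝ) (k : ℕ) : ℝ :=
  Real.sqrt (2 * (1 - γ) ^ 2 * Real.log cardA / (k * cardA))

/-- The mixing time `⌈log_ρ (νlow / (2C))⌉`, at least `1`. -/
noncomputable def tMix (C ρ νlow : ℝ) : ℕ :=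
  max 1 ⌈Real.logb ρ (νlow / (2 * C))⌉₊

/-- The bias term `ε_n`. -/
noncomputable def vbeBias (γ C ρ νlow : ℝ) (n : ℕ) : ℝ :=
  4 * (n + 1) / (1 - γ) * (γ ^ (n - 1) + (1 - νlow / (2 * tMix C ρ νlow)) ^ (n - 1)) +
    8 * (1 - νlow / 2) ^ ⌈(n : ℝ) / tMix C ρ νlow⌉₊ / (1 - γ)

/-! ### KL mirror descent as exponential weights -/

section MirrorDescent

variable {A : Type*} [Fintype A]

/-! The KL mirror descent step is the exponential weights update, so at every state the algorithm
plays a bandit game with losses `Q^{π_t,ξ_t}(s,·)`. Three ingredients give the gap.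

Regret (`mirror_regret`, `IsSPMDRun.sum_mirror_regret`). Because the losses are nonnegative, the
quadratic error is weighted by the current policy: `η²/2 ∑ₐ π(a|s) Q̂(s,a)²`. Each estimate carries
the weight `1/π(a|s)` on an event of probability at most `π(a|s)`, so each summand has mean at most
`(1-γ)⁻²`, however small the policy becomes (`startExp_vbe_sq_le`). The variance therefore costs
only a factor `|A|`, and no forced exploration is needed.

Bias (`startExp_vbe_bias`). Let `τ` be the first visit of `s`. First-step analysis shows that a
first-visit estimate over `n` steps never overshoots in mean, and falls short by at most `(P(τ ≥ n)
+ ∑_{t<n} P(τ ≥ t) γ^{n-t}) / (1-γ)`: either `s` is missed or the sum of costs is truncated. Under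
mixing the chain sits at `s` with probability at least `νlow/2` after each block of `tMix` steps, so
these tails decay geometrically. The bias is one-sided, so paired with a difference of two
probability vectors it costs `ε_n` just once.

Gap (`value_sub_value_eq`, `le_of_le_add_stateKernel`). One step of the performance difference
identity reads `V^π - V^* = ⟨Q^π, π - π*⟩ + γ P_{π*}(V^π - V^*)`. The kernel of `π*` is not random,
so expectations pass through it, and a maximum principle turns a bound on the inner product that is
uniform in the state into a bound on the gap, at the price of `1/(1-γ)`.

For the sample complexity, `k` makes the regret term at most `ε/2`, and `n` of order `L · log L ·
log(1/((1-γ)ε))` with `L = 1/(1-γ) + tMix/νlow` does the same for the bias term. -/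

theorem sum_mul_klFun_div {p q : A → ℝ} (hp : p ∈ stdSimplex ℝ A) (hq : q ∈ stdSimplex ℝ A)
    (hq0 : ∀ a, 0 < q a) :
    ∑ a, q a * InformationTheory.klFun (p a / q a) = klDivVec p q := by
  have h : ∀ a, q a * InformationTheory.klFun (p a / q a)
      = p a * Real.log (p a / q a) + (q a - p a) := by
    intro a
    have := (hq0 a).ne'
    unfold InformationTheory.klFun
    field_simp
    ring
  simp only [h, Finset.sum_add_distrib, Finset.sum_sub_distrib, hp.2, hq.2, klDivVec]
  ring

theorem mul_klFun_div_nonneg {p q : A → ℝ} (hp : p ∈ stdSimplex ℝ A) (hq0 : ∀ a, 0 < q a) (a : A) :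
    0 ≤ q a * InformationTheory.klFun (p a / q a) :=
  mul_nonneg (hq0 a).le (InformationTheory.klFun_nonneg (div_nonneg (hp.1 a) (hq0 a).le))

theorem klDivVec_nonneg {p q : A → ℝ} (hp : p ∈ stdSimplex ℝ A) (hq : q ∈ stdSimplex ℝ A)
    (hq0 : ∀ a, 0 < q a) : 0 ≤ klDivVec p q := by
  rw [← sum_mul_klFun_div hp hq hq0]
  exact Finset.sum_nonneg fun a _ => mul_klFun_div_nonneg hp hq0 a

theorem eq_of_klDivVec_nonpos {p q : A → ℝ} (hp : p ∈ stdSimplex ℝ A) (hq : q ∈ stdSimplex ℝ A)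
    (hq0 : ∀ a, 0 < q a) (h : klDivVec p q ≤ 0) : p = q := by
  have h0 := le_antisymm h (klDivVec_nonneg hp hq hq0)
  rw [← sum_mul_klFun_div hp hq hq0,
    Finset.sum_eq_zero_iff_of_nonneg fun a _ => mul_klFun_div_nonneg hp hq0 a] at h0
  ext a
  have h1 := h0 a (Finset.mem_univ a)
  rw [mul_eq_zero, or_iff_right (hq0 a).ne',
    InformationTheory.klFun_eq_zero_iff (div_nonneg (hp.1 a) (hq0 a).le),
    div_eq_one_iff_eq (hq0 a).ne'] at h1
  exact h1

theorem klDivVec_self {q : A → ℝ} (hq0 : ∀ a, 0 < q a) : klDivVec q q = 0 := by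
  unfold klDivVec
  exact Finset.sum_eq_zero fun a _ => by rw [div_self (hq0 a).ne', Real.log_one, mul_zero]

theorem klDivVec_uniform_le [Nonempty A] {p : A → ℝ} (hp : p ∈ stdSimplex ℝ A) :
    klDivVec p (fun _ => 1 / (Fintype.card A : ℝ)) ≤ Real.log (Fintype.card A) := by
  have hc : (0 : ℝ) < Fintype.card A := by exact_mod_cast Fintype.card_pos
  calc klDivVec p (fun _ => 1 / (Fintype.card A : ℝ))
      ≤ ∑ a, p a * Real.log (Fintype.card A) := by
        refine Finset.sum_le_sum fun a _ => ?_
        rcases (hp.1 a).eq_or_lt with h | h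
        · simp [← h]
        · refine mul_le_mul_of_nonneg_left (Real.log_le_log (by positivity) ?_) h.le
          have : p a ≤ 1 := hp.2 ▸ Finset.single_le_sum (fun b _ => hp.1 b) (Finset.mem_univ a)
          rw [div_div_eq_mul_div, div_one]
          nlinarith
    _ = Real.log (Fintype.card A) := by rw [← Finset.sum_mul, hp.2, one_mul]

/-- The exponential weights update of the probability vector `q` along `g`. -/
noncomputable def expWeights (η : ℝ) (g q : A → ℝ) (a : A) : ℝ :=
  q a * Real.exp (-(η * g a)) / ∑ b, q b * Real.exp (-(η * g b))

theorem expWeights_partition_pos [Nonempty A] (η : ℝ) (g : A → ℝ) {q : A → ℝ} (hq0 : ∀ a, 0 < q a) :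
    0 < ∑ b, q b * Real.exp (-(η * g b)) :=
  Finset.sum_pos (fun b _ => mul_pos (hq0 b) (Real.exp_pos _)) Finset.univ_nonempty

theorem expWeights_pos [Nonempty A] (η : ℝ) (g : A → ℝ) {q : A → ℝ} (hq0 : ∀ a, 0 < q a) (a : A) :
    0 < expWeights η g q a :=
  div_pos (mul_pos (hq0 a) (Real.exp_pos _)) (expWeights_partition_pos η g hq0)

theorem expWeights_mem [Nonempty A] (η : ℝ) (g : A → ℝ) {q : A → ℝ} (hq0 : ∀ a, 0 < q a) :
    expWeights η g q ∈ stdSimplex ℝ A := by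
  refine ⟨fun a => (expWeights_pos η g hq0 a).le, ?_⟩
  unfold expWeights
  rw [← Finset.sum_div, div_self (expWeights_partition_pos η g hq0).ne']

/-- The Gibbs variational identity: the linear term is absorbed into the logarithm of the reweighted
reference. It yields both the closed form of the step and, applied to an arbitrary comparison `p`,
the regret bound. -/
theorem mirror_objective_eq [Nonempty A] (η : ℝ) (g : A → ℝ) {p q : A → ℝ}
    (hp : p ∈ stdSimplex ℝ A) (hq0 : ∀ a, 0 < q a) :
    η * ∑ a, g a * p a + klDivVec p q =
      klDivVec p (expWeights η g q) - Real.log (∑ b, q b * Real.exp (-(η * g b))) := by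
  set Z := ∑ b, q b * Real.exp (-(η * g b)) with hZ
  have hZ0 : 0 < Z := expWeights_partition_pos η g hq0
  have key : ∀ a, p a * Real.log (p a / expWeights η g q a)
      = p a * Real.log (p a / q a) + η * (g a * p a) + p a * Real.log Z := by
    intro a
    rcases (hp.1 a).eq_or_lt with h | h
    · simp [← h]
    · have hq := hq0 a
      have : p a / expWeights η g q a = p a / q a * Real.exp (η * g a) * Z := by
        unfold expWeights
        rw [← hZ, Real.exp_neg]
        have := Real.exp_pos (η * g a)
        field_simp
      rw [this, Real.log_mul (by positivity) hZ0.ne', Real.log_mul (by positivity) (by positivity),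
        Real.log_exp]
      ring
  unfold klDivVec
  simp only [key, Finset.sum_add_distrib, ← Finset.sum_mul, ← Finset.mul_sum, hp.2]
  ring

/-- In `mirror_objective_eq` the partition function does not depend on `p`, so a minimizer has zero
divergence from the exponential weights. -/
theorem eq_expWeights_of_isMinOn [Nonempty A] {η : ℝ} {g p q : A → ℝ}
    (hp : p ∈ stdSimplex ℝ A) (hq0 : ∀ a, 0 < q a)
    (h : IsMinOn (fun p : A → ℝ => η * ∑ a, g a * p a + klDivVec p q) (stdSimplex ℝ A) p) :
    p = expWeights η g q := by
  have hm := expWeights_mem η g hq0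
  have h1 := isMinOn_iff.1 h _ hm
  simp only [mirror_objective_eq η g hp hq0, mirror_objective_eq η g hm hq0,
    klDivVec_self (expWeights_pos η g hq0)] at h1
  exact eq_of_klDivVec_nonpos hp hm (expWeights_pos η g hq0) (by linarith)

theorem exp_neg_le_quadratic {x : ℝ} (hx : 0 ≤ x) : Real.exp (-x) ≤ 1 - x + x ^ 2 / 2 := by
  have h := Real.quadratic_le_exp_of_nonneg hx
  rw [Real.exp_neg]
  refine inv_le_of_inv_le₀ (by nlinarith [sq_nonneg (x - 1)]) (le_trans ?_ h)
  rw [inv_le_iff_one_le_mul₀ (by nlinarith [sq_nonneg (x - 1)])]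
  -- `(1 + x + x²/2)(1 - x + x²/2) = 1 + x⁴/4`.
  nlinarith [sq_nonneg (x ^ 2)]

/-- The variational identity at `p`, followed by `log Z ≤ Z - 1` and the quadratic bound on `exp
(-x)`, which needs nonnegative losses but no upper bound on them. The divergences telescope along
the iterations. -/
theorem mirror_regret [Nonempty A] {η : ℝ} (hη : 0 ≤ η) {g p q : A → ℝ} (hg : ∀ a, 0 ≤ g a)
    (hp : p ∈ stdSimplex ℝ A) (hq : q ∈ stdSimplex ℝ A) (hq0 : ∀ a, 0 < q a) :
    η * ∑ a, g a * (q a - p a) ≤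
      klDivVec p q - klDivVec p (expWeights η g q) + η ^ 2 / 2 * ∑ a, q a * g a ^ 2 := by
  have h := mirror_objective_eq η g hp hq0
  have h1 := Real.log_le_sub_one_of_pos (expWeights_partition_pos η g hq0)
  have h2 : ∑ b, q b * Real.exp (-(η * g b)) ≤
      1 - η * ∑ a, g a * q a + η ^ 2 / 2 * ∑ a, q a * g a ^ 2 := by
    calc ∑ b, q b * Real.exp (-(η * g b))
        ≤ ∑ b, (q b - η * (g b * q b) + η ^ 2 / 2 * (q b * g b ^ 2)) := by
          refine Finset.sum_le_sum fun b _ => ?_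
          have := mul_le_mul_of_nonneg_left
            (exp_neg_le_quadratic (mul_nonneg hη (hg b))) (hq0 b).le
          linarith
      _ = _ := by
          rw [Finset.sum_add_distrib, Finset.sum_sub_distrib, hq.2, ← Finset.mul_sum,
            ← Finset.mul_sum]
  simp only [mul_sub, Finset.sum_sub_distrib]
  linarith

end MirrorDescent

theorem sum_mul_le_of_mem_stdSimplex {ι : Type*} [Fintype ι] {p f : ι → ℝ} {B : ℝ}
    (hp : p ∈ stdSimplex ℝ ι) (hf : ∀ i, f i ≤ B) : ∑ i, p i * f i ≤ B :=
  calc ∑ i, p i * f i ≤ ∑ i, p i * B :=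
        Finset.sum_le_sum fun i _ => mul_le_mul_of_nonneg_left (hf i) (hp.1 i)
    _ = B := by rw [← Finset.sum_mul, hp.2, one_mul]

theorem sum_mul_const_of_mem_stdSimplex {ι : Type*} [Fintype ι] {p : ι → ℝ} (B : ℝ)
    (hp : p ∈ stdSimplex ℝ ι) : ∑ i, p i * B = B := by
  rw [← Finset.sum_mul, hp.2, one_mul]

/-! ### Bellman equations and the performance difference -/

namespace MDP

variable {S A : Type*} [Fintype S]

theorem one_sub_γ_pos (M : MDP S A) : 0 < 1 - M.γ := sub_pos.2 M.γ_lt_one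

/-- The state-action cost with continuation values `V`: `c(s, a) + γ E[V(S_1)]`. -/
noncomputable def lookahead (M : MDP S A) (V : S → ℝ) (s : S) (a : A) : ℝ :=
  M.c s a + M.γ * ∑ s', M.P s a s' * V s'

theorem lookahead_le_lookahead (M : MDP S A) {V W : S → ℝ} (h : ∀ s, V s ≤ W s) (s : S) (a : A) :
    M.lookahead V s a ≤ M.lookahead W s a := by
  unfold lookahead
  have := Finset.sum_le_sum fun s' (_ : s' ∈ Finset.univ) =>
    mul_le_mul_of_nonneg_left (h s') ((M.P_mem s a).1 s')
  have := mul_le_mul_of_nonneg_left this M.γ_pos.le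
  linarith

theorem lookahead_add_const (M : MDP S A) (V : S → ℝ) (b : ℝ) (s : S) (a : A) :
    M.lookahead (fun s' => V s' + b) s a = M.lookahead V s a + M.γ * b := by
  unfold lookahead
  simp only [mul_add, Finset.sum_add_distrib, ← Finset.sum_mul, (M.P_mem s a).2]
  ring

theorem lookahead_nonneg (M : MDP S A) {V : S → ℝ} (hV : ∀ s, 0 ≤ V s) (s : S) (a : A) :
    0 ≤ M.lookahead V s a :=
  add_nonneg (M.c_nonneg s a) (mul_nonneg M.γ_pos.le
    (Finset.sum_nonneg fun s' _ => mul_nonneg ((M.P_mem s a).1 s') (hV s')))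

theorem one_add_γ_mul (M : MDP S A) : 1 + M.γ * (1 / (1 - M.γ)) = 1 / (1 - M.γ) := by
  have := M.one_sub_γ_pos
  field_simp
  ring

theorem lookahead_le (M : MDP S A) {V : S → ℝ} (hV : ∀ s, V s ≤ 1 / (1 - M.γ)) (s : S) (a : A) :
    M.lookahead V s a ≤ 1 / (1 - M.γ) := by
  rw [← M.one_add_γ_mul]
  exact add_le_add (M.c_le_one s a)
    (mul_le_mul_of_nonneg_left (sum_mul_le_of_mem_stdSimplex (M.P_mem s a) hV) M.γ_pos.le)

variable [Fintype A]

theorem stateKernel_mem (M : MDP S A) {π : S → A → ℝ} (hπ : IsPolicy π) (s : S) :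
    M.stateKernel π s ∈ stdSimplex ℝ S := by
  refine ⟨fun s' => Finset.sum_nonneg fun a _ => mul_nonneg ((hπ s).1 a) ((M.P_mem s a).1 s'), ?_⟩
  unfold stateKernel
  rw [Finset.sum_comm]
  simp only [← Finset.mul_sum, (M.P_mem s _).2, mul_one, (hπ s).2]

theorem sum_stateKernel_mul (M : MDP S A) (π : S → A → ℝ) (s : S) (f : S → ℝ) :
    ∑ s', M.stateKernel π s s' * f s' = ∑ a, π s a * ∑ s', M.P s a s' * f s' := by
  unfold stateKernel
  simp only [Finset.sum_mul, Finset.mul_sum]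
  rw [Finset.sum_comm]
  simp only [mul_assoc]

/-- `stateDist` is defined by its last step; the Bellman equation needs the first step. -/
theorem stateDist_succ_first (M : MDP S A) (π : S → A → ℝ) (t : ℕ) (s₀ s : S) :
    M.stateDist π s₀ (t + 1) s = ∑ s', M.stateKernel π s₀ s' * M.stateDist π s' t s := by
  classical
  induction t generalizing s with
  | zero => simp [stateDist]
  | succ t ih =>
    rw [stateDist]
    simp only [ih, Finset.sum_mul]
    rw [Finset.sum_comm]
    refine Finset.sum_congr rfl fun s' _ => ?_
    rw [stateDist, Finset.mul_sum]
    simp only [mul_assoc]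

theorem stateDist_mem (M : MDP S A) {π : S → A → ℝ} (hπ : IsPolicy π) (s₀ : S) (t : ℕ) :
    M.stateDist π s₀ t ∈ stdSimplex ℝ S := by
  classical
  induction t with
  | zero =>
    refine ⟨fun s => ?_, ?_⟩
    · unfold stateDist; split_ifs <;> norm_num
    · simp [stateDist]
  | succ t ih =>
    refine ⟨fun s => Finset.sum_nonneg fun s' _ =>
      mul_nonneg (ih.1 s') ((M.stateKernel_mem hπ s').1 s), ?_⟩
    unfold stateDist
    rw [Finset.sum_comm]
    simp only [← Finset.mul_sum, (M.stateKernel_mem hπ _).2, mul_one, ih.2]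

theorem sum_stateDist_succ_mul (M : MDP S A) (π : S → A → ℝ) (t : ℕ) (s₀ : S) (f : S → ℝ) :
    ∑ s, M.stateDist π s₀ (t + 1) s * f s =
      ∑ s', M.stateKernel π s₀ s' * ∑ s, M.stateDist π s' t s * f s := by
  simp only [stateDist_succ_first, Finset.sum_mul, Finset.mul_sum]
  rw [Finset.sum_comm]
  simp only [mul_assoc]

/-- The expected cost at time `t`. -/
noncomputable def meanCost (M : MDP S A) (π : S → A → ℝ) (s : S) (t : ℕ) : ℝ :=
  ∑ s', M.stateDist π s t s' * ∑ a, π s' a * M.c s' a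

theorem meanCost_nonneg (M : MDP S A) {π : S → A → ℝ} (hπ : IsPolicy π) (s : S) (t : ℕ) :
    0 ≤ M.meanCost π s t :=
  Finset.sum_nonneg fun s' _ => mul_nonneg ((M.stateDist_mem hπ s t).1 s')
    (Finset.sum_nonneg fun a _ => mul_nonneg ((hπ s').1 a) (M.c_nonneg s' a))

theorem meanCost_le_one (M : MDP S A) {π : S → A → ℝ} (hπ : IsPolicy π) (s : S) (t : ℕ) :
    M.meanCost π s t ≤ 1 :=
  sum_mul_le_of_mem_stdSimplex (M.stateDist_mem hπ s t) fun s' =>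
    sum_mul_le_of_mem_stdSimplex (hπ s') (M.c_le_one s')

theorem summable_value (M : MDP S A) {π : S → A → ℝ} (hπ : IsPolicy π) (s : S) :
    Summable fun t => M.γ ^ t * M.meanCost π s t :=
  Summable.of_nonneg_of_le
    (fun t => mul_nonneg (pow_nonneg M.γ_pos.le t) (M.meanCost_nonneg hπ s t))
    (fun t => mul_le_of_le_one_right (pow_nonneg M.γ_pos.le t) (M.meanCost_le_one hπ s t))
    (summable_geometric_of_lt_one M.γ_pos.le M.γ_lt_one)

theorem value_nonneg (M : MDP S A) {π : S → A → ℝ} (hπ : IsPolicy π) (s : S) :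
    0 ≤ M.value π s :=
  tsum_nonneg fun t => mul_nonneg (pow_nonneg M.γ_pos.le t) (M.meanCost_nonneg hπ s t)

theorem value_le (M : MDP S A) {π : S → A → ℝ} (hπ : IsPolicy π) (s : S) :
    M.value π s ≤ 1 / (1 - M.γ) := by
  rw [one_div, ← tsum_geometric_of_lt_one M.γ_pos.le M.γ_lt_one]
  exact (M.summable_value hπ s).tsum_le_tsum
    (fun t => mul_le_of_le_one_right (pow_nonneg M.γ_pos.le t) (M.meanCost_le_one hπ s t))
    (summable_geometric_of_lt_one M.γ_pos.le M.γ_lt_one)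

theorem sum_mul_lookahead (M : MDP S A) (π : S → A → ℝ) (V : S → ℝ) (s : S) :
    ∑ a, π s a * M.lookahead V s a =
      ∑ a, π s a * M.c s a + M.γ * ∑ s', M.stateKernel π s s' * V s' := by
  rw [sum_stateKernel_mul]
  unfold lookahead
  simp only [mul_add, Finset.sum_add_distrib, Finset.mul_sum]
  congr 1
  refine Finset.sum_congr rfl fun a _ => Finset.sum_congr rfl fun s' _ => by ring

theorem value_eq_sum_lookahead (M : MDP S A) {π : S → A → ℝ} (hπ : IsPolicy π) (s : S) :
    M.value π s = ∑ a, π s a * M.lookahead (M.value π) s a := by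
  classical
  rw [sum_mul_lookahead]
  have h := (M.summable_value hπ s).tsum_eq_zero_add
  change M.value π s = _ at h
  rw [h]
  have h0 : M.meanCost π s 0 = ∑ a, π s a * M.c s a := by simp [meanCost, stateDist]
  rw [h0, pow_zero, one_mul]
  congr 1
  have h1 : ∀ t, M.γ ^ (t + 1) * M.meanCost π s (t + 1) =
      M.γ * ∑ s', M.stateKernel π s s' * (M.γ ^ t * M.meanCost π s' t) := by
    intro t
    rw [meanCost, sum_stateDist_succ_mul]
    simp only [Finset.mul_sum, meanCost]
    refine Finset.sum_congr rfl fun s' _ => Finset.sum_congr rfl fun s'' _ =>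
      Finset.sum_congr rfl fun a _ => by ring
  simp only [h1]
  rw [tsum_mul_left, Summable.tsum_finsetSum fun s' _ => (M.summable_value hπ s').mul_left _]
  simp only [tsum_mul_left]
  rfl

/-- The value function truncated after `m` steps. -/
noncomputable def truncValue (M : MDP S A) (π : S → A → ℝ) : ℕ → S → ℝ
  | 0 => fun _ => 0
  | m + 1 => fun s => ∑ a, π s a * M.lookahead (M.truncValue π m) s a

theorem truncValue_le (M : MDP S A) {π : S → A → ℝ} (hπ : IsPolicy π) (m : ℕ) (s : S) :
    M.truncValue π m s ≤ M.value π s := by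
  induction m generalizing s with
  | zero => exact M.value_nonneg hπ s
  | succ m ih =>
    rw [value_eq_sum_lookahead M hπ]
    exact Finset.sum_le_sum fun a _ =>
      mul_le_mul_of_nonneg_left (M.lookahead_le_lookahead ih s a) ((hπ s).1 a)

theorem value_le_truncValue_add (M : MDP S A) {π : S → A → ℝ} (hπ : IsPolicy π) (m : ℕ) (s : S) :
    M.value π s ≤ M.truncValue π m s + M.γ ^ m / (1 - M.γ) := by
  induction m generalizing s with
  | zero => simpa [truncValue] using M.value_le hπ s
  | succ m ih =>
    rw [value_eq_sum_lookahead M hπ]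
    calc ∑ a, π s a * M.lookahead (M.value π) s a
        ≤ ∑ a, π s a * (M.lookahead (M.truncValue π m) s a + M.γ ^ (m + 1) / (1 - M.γ)) := by
          refine Finset.sum_le_sum fun a _ => mul_le_mul_of_nonneg_left ?_ ((hπ s).1 a)
          refine (M.lookahead_le_lookahead ih s a).trans ?_
          rw [lookahead_add_const, pow_succ']
          exact le_of_eq (by ring)
      _ = _ := by
          simp only [mul_add, Finset.sum_add_distrib, sum_mul_const_of_mem_stdSimplex _ (hπ s)]
          rfl

/-- The performance difference identity, left as a one-step recursion. Here `lookahead (value π)` is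
the Q-function of `π`, and the kernel is that of the comparison policy, which stays fixed when `π`
becomes random. -/
theorem value_sub_value_eq (M : MDP S A) {π πstar : S → A → ℝ} (hπ : IsPolicy π)
    (hstar : IsPolicy πstar) (s : S) :
    M.value π s - M.value πstar s =
      ∑ a, M.lookahead (M.value π) s a * (π s a - πstar s a) +
        M.γ * ∑ s', M.stateKernel πstar s s' * (M.value π s' - M.value πstar s') := by
  rw [M.value_eq_sum_lookahead hπ s, M.value_eq_sum_lookahead hstar s]
  have h1 := M.sum_mul_lookahead πstar (M.value π) s
  have h2 := M.sum_mul_lookahead πstar (M.value πstar) s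
  simp only [mul_comm (M.lookahead _ _ _), mul_sub, sub_mul, Finset.sum_sub_distrib]
  linarith

/-- A bound for the solutions of `D ≤ B + γ K D`. -/
theorem le_of_le_add_stateKernel (M : MDP S A) {π : S → A → ℝ} (hπ : IsPolicy π) {D : S → ℝ} {B : ℝ}
    (h : ∀ s, D s ≤ B + M.γ * ∑ s', M.stateKernel π s s' * D s') (s : S) :
    D s ≤ B / (1 - M.γ) := by
  have : Nonempty S := ⟨s⟩
  obtain ⟨m, hm⟩ := Finite.exists_max D
  -- At a maximizer of `D` the kernel average is at most the maximum itself.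
  have h1 := sum_mul_le_of_mem_stdSimplex (M.stateKernel_mem hπ m) hm
  have h2 := mul_le_mul_of_nonneg_left h1 M.γ_pos.le
  rw [le_div_iff₀ M.one_sub_γ_pos]
  have := h m
  have := hm s
  nlinarith [M.one_sub_γ_pos]

end MDP

/-! ### First-visit functionals under prepending a pair -/

section FirstVisit

variable {S A : Type*}

theorem cons_castSucc {α : Type*} {n : ℕ} (p : α) (z : Fin (n + 1) → α) :
    (fun i : Fin (n + 1) => (Fin.cons p z : Fin (n + 2) → α) i.castSucc) =
      Fin.cons p fun i : Fin n => z i.castSucc := by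
  ext i
  refine Fin.cases rfl (fun j => ?_) i
  rw [Fin.castSucc_succ, Fin.cons_succ, Fin.cons_succ]

theorem hitTime_le {n : ℕ} (z : Fin n → S × A) (s : S) : hitTime z s ≤ n :=
  Nat.sInf_le (Or.inr rfl)

open Classical in
theorem hitTime_cons {n : ℕ} (p : S × A) (z : Fin n → S × A) (s : S) :
    hitTime (Fin.cons p z : Fin (n + 1) → S × A) s = if p.1 = s then 0 else hitTime z s + 1 := by
  split_ifs with h
  · exact Nat.eq_zero_of_le_zero (Nat.sInf_le (Or.inl ⟨n.succ_pos, h⟩))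
  · refine le_antisymm (Nat.sInf_le ?_) (le_csInf ⟨_, Or.inr rfl⟩ ?_)
    · rcases Nat.sInf_mem (s := {t | ∃ h : t < n, (z ⟨t, h⟩).1 = s} ∪ {n}) ⟨n, Or.inr rfl⟩ with
        ⟨h1, h2⟩ | h1
      · exact Or.inl ⟨Nat.succ_lt_succ h1, h2⟩
      · exact Or.inr (congrArg (· + 1) h1)
    · rintro t (⟨h1, h2⟩ | h1)
      · cases t with
        | zero => exact absurd h2 h
        | succ t => exact Nat.succ_le_succ (Nat.sInf_le (Or.inl ⟨Nat.lt_of_succ_lt_succ h1, h2⟩))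
      · rw [Set.mem_singleton_iff] at h1
        rw [h1]
        exact Nat.succ_le_succ (hitTime_le z s)

open Classical in
/-- The indicator that the state `s` is visited and `a` is the action of the first visit. -/
noncomputable def firstActionInd {n : ℕ} (z : Fin n → S × A) (s : S) (a : A) : ℝ :=
  if h : hitTime z s < n then (if a = (z ⟨hitTime z s, h⟩).2 then 1 else 0) else 0

theorem firstActionInd_nonneg {n : ℕ} (z : Fin n → S × A) (s : S) (a : A) :
    0 ≤ firstActionInd z s a := by
  unfold firstActionInd
  split_ifs <;> norm_num

theorem firstActionInd_sq {n : ℕ} (z : Fin n → S × A) (s : S) (a : A) :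
    firstActionInd z s a ^ 2 = firstActionInd z s a := by
  unfold firstActionInd
  split_ifs <;> norm_num

open Classical in
theorem firstActionInd_cons {n : ℕ} (p : S × A) (z : Fin n → S × A) (s : S) (a : A) :
    firstActionInd (Fin.cons p z : Fin (n + 1) → S × A) s a =
      if p.1 = s then (if a = p.2 then 1 else 0) else firstActionInd z s a := by
  have h := hitTime_cons p z s
  unfold firstActionInd
  split_ifs at h with hp
  · simp [h, hp]
  · simp only [h, hp, Nat.add_lt_add_iff_right, if_false]
    rfl

variable [Fintype S]

/-- The discounted cost of a trajectory. -/
noncomputable def discountedCost (M : MDP S A) {n : ℕ} (z : Fin n → S × A) : ℝ :=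
  ∑ t : Fin n, M.γ ^ t.1 * M.c (z t).1 (z t).2

theorem discountedCost_cons (M : MDP S A) {n : ℕ} (p : S × A) (z : Fin n → S × A) :
    discountedCost M (Fin.cons p z : Fin (n + 1) → S × A) =
      M.c p.1 p.2 + M.γ * discountedCost M z := by
  simp [discountedCost, Fin.sum_univ_succ, Finset.mul_sum, pow_succ', mul_assoc]

theorem discountedCost_le (M : MDP S A) {n : ℕ} (z : Fin n → S × A) :
    discountedCost M z ≤ 1 / (1 - M.γ) := by
  induction n with
  | zero => simpa [discountedCost] using M.one_sub_γ_pos.le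
  | succ n ih =>
    rw [← Fin.cons_self_tail z, discountedCost_cons, ← M.one_add_γ_mul]
    exact add_le_add (M.c_le_one _ _) (mul_le_mul_of_nonneg_left (ih _) M.γ_pos.le)

open Classical in
theorem omcValue_cons (M : MDP S A) {n : ℕ} (p : S × A) (z : Fin n → S × A) (s : S) :
    omcValue M (Fin.cons p z : Fin (n + 1) → S × A) s =
      if p.1 = s then M.c p.1 p.2 + M.γ * discountedCost M z else omcValue M z s := by
  have h := hitTime_cons p z s
  split_ifs at h ⊢ with hp
  · rw [← discountedCost_cons]
    simp [omcValue, h, discountedCost]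
  · simp [omcValue, h, Fin.sum_univ_succ]

theorem omcValue_nonneg (M : MDP S A) {n : ℕ} (z : Fin n → S × A) (s : S) :
    0 ≤ omcValue M z s := by
  refine Finset.sum_nonneg fun t _ => ?_
  split_ifs
  · exact mul_nonneg (pow_nonneg M.γ_pos.le _) (M.c_nonneg _ _)
  · exact le_rfl

theorem omcValue_le (M : MDP S A) {n : ℕ} (z : Fin n → S × A) (s : S) :
    omcValue M z s ≤ 1 / (1 - M.γ) := by
  induction n with
  | zero => simpa [omcValue] using M.one_sub_γ_pos.le
  | succ n ih =>
    rw [← Fin.cons_self_tail z, omcValue_cons]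
    split_ifs
    · rw [← discountedCost_cons]
      exact discountedCost_le M _
    · exact ih _

open Classical in
/-- The one-step estimate of `Q(s, a)` from the first visit of `s`, with importance weight `w` and
continuation values `f`. -/
noncomputable def bootstrapEstimate (M : MDP S A) (f : S → ℝ) (w : ℝ) {n : ℕ}
    (z : Fin (n + 1) → S × A) (s : S) (a : A) : ℝ :=
  if h : hitTime (fun i : Fin n => z i.castSucc) s < n then
    (if a = (z ⟨hitTime (fun i : Fin n => z i.castSucc) s, by omega⟩).2 then 1 else 0) / w *
      (M.c s a + M.γ * f (z ⟨hitTime (fun i : Fin n => z i.castSucc) s + 1, by omega⟩).1)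
  else 0

open Classical in
theorem bootstrapEstimate_cons (M : MDP S A) (f : S → ℝ) (w : ℝ) {n : ℕ} (p : S × A)
    (z : Fin (n + 1) → S × A) (s : S) (a : A) :
    bootstrapEstimate M f w (Fin.cons p z : Fin (n + 2) → S × A) s a =
      if p.1 = s then (if a = p.2 then 1 else 0) / w * (M.c s a + M.γ * f (z 0).1)
      else bootstrapEstimate M f w z s a := by
  have h := hitTime_cons p (fun i : Fin n => z i.castSucc) s
  unfold bootstrapEstimate
  rw [← cons_castSucc] at h
  split_ifs at h with hp
  · simp only [h, hp, if_true, Nat.succ_pos, dite_true]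
    rfl
  · simp only [h, hp, Nat.add_lt_add_iff_right, if_false]
    rfl

/-- For sign and size only the form of the estimate matters, not which successor state is read; if
`s` is missed the indicator vanishes and any `s'` will do. -/
theorem exists_bootstrapEstimate_eq (M : MDP S A) (f : S → ℝ) (w : ℝ) {n : ℕ}
    (z : Fin (n + 1) → S × A) (s : S) (a : A) : ∃ s',
    bootstrapEstimate M f w z s a =
      firstActionInd (fun i : Fin n => z i.castSucc) s a / w * (M.c s a + M.γ * f s') := by
  by_cases h : hitTime (fun i : Fin n => z i.castSucc) s < n
  · unfold bootstrapEstimate firstActionInd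
    rw [dif_pos h, dif_pos h]
    exact ⟨_, rfl⟩
  · exact ⟨s, by simp [bootstrapEstimate, firstActionInd, h]⟩

theorem vbeIIEstimate_eq (M : MDP S A) {n : ℕ} (π : S → A → ℝ)
    (ξ : Fin (n + 1) → S × A) (s : S) (a : A) :
    vbeIIEstimate M π ξ s a = firstActionInd (fun i : Fin n => ξ i.castSucc) s a / π s a *
      omcValue M (fun i : Fin n => ξ i.castSucc) s := by
  by_cases h : hitTime (fun i : Fin n => ξ i.castSucc) s < n
  · unfold vbeIIEstimate firstActionInd
    simp only [dif_pos h]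
    rfl
  · simp [vbeIIEstimate, firstActionInd, h]

end FirstVisit

/-! ### Trajectory expectations and the bias of first-visit estimates -/

namespace MDP

variable {S A : Type*} [Fintype S]

theorem trajProb_cons (M : MDP S A) {m : ℕ} (π : S → A → ℝ) (p : S × A)
    (z : Fin (m + 1) → S × A) :
    M.trajProb π (Fin.cons p z : Fin (m + 2) → S × A) =
      π p.1 p.2 * (M.P p.1 p.2 (z 0).1 * M.trajProb π z) := by
  have h : ∀ i : Fin (m + 1),
      (if h : i.succ.1 + 1 < m + 2 then
        M.P ((Fin.cons p z : Fin (m + 2) → S × A) i.succ).1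
          ((Fin.cons p z : Fin (m + 2) → S × A) i.succ).2
          ((Fin.cons p z : Fin (m + 2) → S × A) ⟨i.succ.1 + 1, h⟩).1 else 1) =
      if h : i.1 + 1 < m + 1 then M.P (z i).1 (z i).2 (z ⟨i.1 + 1, h⟩).1 else 1 := by
    intro i
    by_cases hi : i.1 + 1 < m + 1
    · rw [dif_pos hi, dif_pos (by simpa using hi)]
      rfl
    · rw [dif_neg hi, dif_neg (by simpa using hi)]
  unfold trajProb
  rw [Fin.prod_univ_succ, Fin.prod_univ_succ (n := m + 1), Finset.prod_congr rfl fun i _ => h i]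
  simp only [Fin.cons_zero, Fin.cons_succ, Fin.val_zero]
  rw [dif_pos (by omega)]
  have : (Fin.cons p z : Fin (m + 2) → S × A) ⟨0 + 1, by omega⟩ = z 0 := rfl
  rw [this]
  ring

variable [Fintype A]

/-- The expectation of `g (Z_0, ..., Z_{m-1})` for the trajectory of `π` started at `s`. -/
noncomputable def trajExp (M : MDP S A) (π : S → A → ℝ) :
    (m : ℕ) → S → ((Fin m → S × A) → ℝ) → ℝ
  | 0, _, g => g Fin.elim0
  | m + 1, s, g => ∑ a, π s a * ∑ s', M.P s a s' *
      M.trajExp π m s' fun z => g (Fin.cons (s, a) z)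

theorem sum_cons {α : Type*} [Fintype α] {m : ℕ} (F : (Fin (m + 1) → α) → ℝ) :
    ∑ z, F z = ∑ p, ∑ z, F (Fin.cons p z) := by
  rw [← (Fin.consEquiv fun _ => α).sum_comp, Fintype.sum_prod_type]
  rfl

open Classical in
-- Translates the product formula for path probabilities into a recursion on the first step, on
-- which all later inductions run.
theorem sum_trajProb_mul_eq_trajExp (M : MDP S A) (π : S → A → ℝ) (m : ℕ) (s : S)
    (g : (Fin (m + 1) → S × A) → ℝ) :
    ∑ z : Fin (m + 1) → S × A, (if (z 0).1 = s then M.trajProb π z * g z else 0) =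
      M.trajExp π (m + 1) s g := by
  have hs : ∀ (s : S) (F : S → A → ℝ),
      ∑ p : S × A, (if p.1 = s then F p.1 p.2 else 0) = ∑ a, F s a := by
    intro s F
    rw [Fintype.sum_prod_type, Finset.sum_comm]
    simp
  induction m generalizing s with
  | zero =>
    rw [sum_cons]
    simp only [Fin.cons_zero, Fintype.sum_unique]
    have := hs s fun s a => M.trajProb π (Fin.cons (s, a) default : Fin 1 → S × A) *
      g (Fin.cons (s, a) default)
    refine this.trans (Finset.sum_congr rfl fun a _ => ?_)
    -- `trajExp` draws a successor state even after the last pair; nothing reads it, and its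
    -- probabilities sum to one.
    simp only [trajProb, trajExp, ← Finset.sum_mul, (M.P_mem s a).2]
    simp
    left
    congr
  | succ m ih =>
    rw [sum_cons]
    simp only [Fin.cons_zero]
    have := hs s fun s a => ∑ z : Fin (m + 1) → S × A,
      M.trajProb π (Fin.cons (s, a) z : Fin (m + 2) → S × A) * g (Fin.cons (s, a) z)
    refine Eq.trans (Finset.sum_congr rfl fun p _ => ?_)
      (this.trans (Finset.sum_congr rfl fun a _ => ?_))
    · split_ifs <;> simp
    · have hi : ∀ s', M.trajExp π (m + 1) s' (fun z => g (Fin.cons (s, a) z)) = _ := fun s' =>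
        (ih s' fun z => g (Fin.cons (s, a) z)).symm
      simp only [hi, Finset.mul_sum]
      rw [Finset.sum_comm]
      refine Finset.sum_congr rfl fun z _ => ?_
      rw [trajProb_cons]
      simp
      ring

open Classical in
theorem sum_sameStart_trajProb_mul (M : MDP S A) (π : S → A → ℝ) {m : ℕ}
    (z₀ : Fin (m + 1) → S × A) (g : (Fin (m + 1) → S × A) → ℝ) :
    ∑ z : Fin (m + 1) → S × A, (if SameStart z₀ z then M.trajProb π z * g z else 0) =
      M.trajExp π (m + 1) (z₀ 0).1 g := by
  rw [← sum_trajProb_mul_eq_trajExp]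
  refine Finset.sum_congr rfl fun z _ => ?_
  have : SameStart z₀ z ↔ (z 0).1 = (z₀ 0).1 := by
    refine ⟨fun h => (h 0 rfl).symm, fun h i hi => ?_⟩
    have : i = 0 := Fin.ext hi
    rw [this, h]
  simp only [this]

theorem trajExp_const_add_mul (M : MDP S A) {π : S → A → ℝ} (hπ : IsPolicy π) (m : ℕ) (s : S)
    (c d : ℝ) (g : (Fin m → S × A) → ℝ) :
    M.trajExp π m s (fun z => c + d * g z) = c + d * M.trajExp π m s g := by
  induction m generalizing s with
  | zero => rfl
  | succ m ih =>
    simp only [trajExp, ih, mul_add, Finset.sum_add_distrib,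
      sum_mul_const_of_mem_stdSimplex _ (M.P_mem s _), sum_mul_const_of_mem_stdSimplex _ (hπ s)]
    congr 1
    simp only [Finset.mul_sum]
    refine Finset.sum_congr rfl fun a _ => Finset.sum_congr rfl fun s' _ => by ring

theorem trajExp_const (M : MDP S A) {π : S → A → ℝ} (hπ : IsPolicy π) (m : ℕ) (s : S) (c : ℝ) :
    M.trajExp π m s (fun _ => c) = c := by
  simpa using M.trajExp_const_add_mul hπ m s c 0 fun _ => 0

theorem trajExp_const_mul (M : MDP S A) {π : S → A → ℝ} (hπ : IsPolicy π) (m : ℕ) (s : S)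
    (d : ℝ) (g : (Fin m → S × A) → ℝ) :
    M.trajExp π m s (fun z => d * g z) = d * M.trajExp π m s g := by
  simpa using M.trajExp_const_add_mul hπ m s 0 d g

theorem trajExp_sum {ι : Type*} (I : Finset ι) (M : MDP S A) (π : S → A → ℝ) (m : ℕ) (s : S)
    (g : ι → (Fin m → S × A) → ℝ) :
    M.trajExp π m s (fun z => ∑ i ∈ I, g i z) = ∑ i ∈ I, M.trajExp π m s (g i) := by
  induction m generalizing s with
  | zero => rfl
  | succ m ih =>
    simp only [trajExp, ih, Finset.mul_sum]
    conv_rhs => rw [Finset.sum_comm]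
    refine Finset.sum_congr rfl fun a _ => ?_
    rw [Finset.sum_comm]

theorem trajExp_mono (M : MDP S A) {π : S → A → ℝ} (hπ : IsPolicy π) (m : ℕ) (s : S)
    {g h : (Fin m → S × A) → ℝ} (hgh : ∀ z, g z ≤ h z) :
    M.trajExp π m s g ≤ M.trajExp π m s h := by
  induction m generalizing s with
  | zero => exact hgh _
  | succ m ih =>
    exact Finset.sum_le_sum fun a _ => mul_le_mul_of_nonneg_left
      (Finset.sum_le_sum fun s' _ => mul_le_mul_of_nonneg_left (ih _ fun z => hgh _)
        ((M.P_mem s a).1 s')) ((hπ s).1 a)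

/-- A final pair that is not read integrates out. This handles samples with `n + 1` pairs of which
the estimate uses `n`. -/
theorem trajExp_castSucc (M : MDP S A) {π : S → A → ℝ} (hπ : IsPolicy π) (m : ℕ) (s : S)
    (g : (Fin m → S × A) → ℝ) :
    M.trajExp π (m + 1) s (fun z => g fun i : Fin m => z i.castSucc) = M.trajExp π m s g := by
  induction m generalizing s with
  | zero =>
    have : ∀ z : Fin 1 → S × A, g (fun i : Fin 0 => z i.castSucc) = g Fin.elim0 := fun z =>
      congrArg g (Subsingleton.elim _ _)
    simp only [this, trajExp_const M hπ]
    rfl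
  | succ m ih =>
    rw [trajExp]
    simp only [cons_castSucc]
    refine Finset.sum_congr rfl fun a _ => ?_
    congr 1
    refine Finset.sum_congr rfl fun s' _ => ?_
    congr 1
    exact ih s' fun z => g (Fin.cons (s, a) z)

theorem trajExp_initial (M : MDP S A) {π : S → A → ℝ} (hπ : IsPolicy π) (m : ℕ) (s : S)
    (f : S → ℝ) : M.trajExp π (m + 1) s (fun z => f (z 0).1) = f s := by
  rw [trajExp]
  simp only [Fin.cons_zero, trajExp_const M hπ, sum_mul_const_of_mem_stdSimplex _ (M.P_mem s _),
    sum_mul_const_of_mem_stdSimplex _ (hπ s)]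

theorem trajExp_discountedCost (M : MDP S A) {π : S → A → ℝ} (hπ : IsPolicy π) (m : ℕ) (s : S) :
    M.trajExp π m s (discountedCost M) = M.truncValue π m s := by
  induction m generalizing s with
  | zero => simp [trajExp, discountedCost, truncValue]
  | succ m ih =>
    simp only [trajExp, truncValue, lookahead, discountedCost_cons, trajExp_const_add_mul M hπ, ih,
      mul_add, Finset.sum_add_distrib, sum_mul_const_of_mem_stdSimplex _ (M.P_mem s _)]
    congr 1
    simp only [Finset.mul_sum]
    refine Finset.sum_congr rfl fun a _ => Finset.sum_congr rfl fun s' _ => by ring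

open Classical in
/-- The probability that the chain of `π` started at `s₀` does not visit `s` before time `n`. -/
noncomputable def avoidProb (M : MDP S A) (π : S → A → ℝ) (s : S) : ℕ → S → ℝ
  | 0 => fun _ => 1
  | n + 1 => fun s₀ =>
      if s₀ = s then 0 else ∑ r, M.stateKernel π s₀ r * M.avoidProb π s n r

/-- A functional of the trajectory that does not depend on what precedes the first visit of `s`. -/
theorem trajExp_succ_of_ne (M : MDP S A) {π : S → A → ℝ} {m : ℕ} {s s₀ : S} (h : s₀ ≠ s)
    {g : (Fin (m + 1) → S × A) → ℝ} {g' : (Fin m → S × A) → ℝ}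
    (hg : ∀ (p : S × A) z, p.1 ≠ s → g (Fin.cons p z) = g' z) :
    M.trajExp π (m + 1) s₀ g = ∑ s', M.stateKernel π s₀ s' * M.trajExp π m s' g' := by
  rw [sum_stateKernel_mul, trajExp]
  refine Finset.sum_congr rfl fun a _ => ?_
  congr 1
  refine Finset.sum_congr rfl fun s' _ => ?_
  congr 2
  ext z
  exact hg (s₀, a) z h

open Classical in
-- Started at `s`, the first visit is at time `0`, and the indicator of the action keeps one term
-- with weight `π s a`; this is the factor that importance weighting cancels.
theorem trajExp_succ_weight (M : MDP S A) {π : S → A → ℝ} (hπ : IsPolicy π) {m : ℕ} (s : S) (a : A)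
    (F : S → A → (Fin m → S × A) → ℝ) {g : (Fin (m + 1) → S × A) → ℝ}
    (hg : ∀ a' z, g (Fin.cons (s, a') z) = (if a = a' then 1 else 0) * F s a' z) :
    M.trajExp π (m + 1) s g = π s a * ∑ s', M.P s a s' * M.trajExp π m s' (F s a) := by
  rw [trajExp]
  simp only [hg, trajExp_const_mul M hπ]
  rw [Finset.sum_eq_single a]
  · simp
  · intro b _ hb
    simp [hb.symm]
  · simp

/-- The action at the first visit is drawn from `π s` independently of whether the visit takes
place. -/
theorem trajExp_firstActionInd (M : MDP S A) {π : S → A → ℝ} (hπ : IsPolicy π) (n : ℕ)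
    (s₀ s : S) (a : A) :
    M.trajExp π n s₀ (fun z => firstActionInd z s a) = π s a * (1 - M.avoidProb π s n s₀) := by
  classical
  induction n generalizing s₀ with
  | zero => simp [trajExp, firstActionInd, avoidProb]
  | succ n ih =>
    by_cases h : s₀ = s
    · subst h
      rw [M.trajExp_succ_weight hπ s₀ a (fun _ _ _ => 1) fun a' z => by
        rw [firstActionInd_cons]; simp]
      simp [avoidProb, trajExp_const M hπ, (M.P_mem s₀ a).2]
    · rw [M.trajExp_succ_of_ne h (g' := fun z => firstActionInd z s a) fun p z hp => by
        rw [firstActionInd_cons, if_neg hp]]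
      simp only [ih, avoidProb, if_neg h, mul_sub, mul_one, Finset.sum_sub_distrib,
        sum_mul_const_of_mem_stdSimplex _ (M.stateKernel_mem hπ s₀), Finset.mul_sum]
      congr 1
      exact Finset.sum_congr rfl fun s' _ => by ring

/-- Once `s` is visited the importance weight makes the one-step estimate unbiased, so the only loss
is the event that `s` is missed. -/
theorem trajExp_bootstrapEstimate (M : MDP S A) {π : S → A → ℝ} (hπ : IsPolicy π) (n : ℕ)
    (s₀ s : S) (a : A) (ha : π s a ≠ 0) (f : S → ℝ) :
    M.trajExp π (n + 1) s₀ (fun z => bootstrapEstimate M f (π s a) z s a) =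
      (1 - M.avoidProb π s n s₀) * M.lookahead f s a := by
  classical
  induction n generalizing s₀ with
  | zero => simp [bootstrapEstimate, avoidProb, trajExp_const M hπ]
  | succ n ih =>
    by_cases h : s₀ = s
    · subst h
      rw [M.trajExp_succ_weight hπ s₀ a
        (fun _ _ z => M.c s₀ a / π s₀ a + M.γ / π s₀ a * f (z 0).1) fun a' z => by
          rw [bootstrapEstimate_cons, if_pos rfl]; ring]
      simp only [trajExp_const_add_mul M hπ, trajExp_initial M hπ _ _ f, mul_add,
        Finset.sum_add_distrib, sum_mul_const_of_mem_stdSimplex _ (M.P_mem s₀ a), avoidProb,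
        if_true, lookahead, Finset.mul_sum]
      simp only [sub_zero, one_mul]
      rw [mul_div_cancel₀ _ ha]
      congr 1
      refine Finset.sum_congr rfl fun s' _ => ?_
      field_simp
    · rw [M.trajExp_succ_of_ne h (g' := fun z => bootstrapEstimate M f (π s a) z s a)
        fun p z hp => by rw [bootstrapEstimate_cons, if_neg hp]]
      simp only [ih, avoidProb, if_neg h, ← mul_assoc, ← Finset.sum_mul, mul_sub, mul_one,
        Finset.sum_sub_distrib, (M.stateKernel_mem hπ s₀).2]

/-- The bias of first-visit estimation over `n` steps. -/
noncomputable def visitBias (M : MDP S A) (π : S → A → ℝ) (s : S) (n : ℕ) (s₀ : S) : ℝ :=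
  (∑ t ∈ Finset.range n, M.avoidProb π s t s₀ * M.γ ^ (n - t) + M.avoidProb π s n s₀) / (1 - M.γ)

theorem avoidProb_nonneg (M : MDP S A) {π : S → A → ℝ} (hπ : IsPolicy π) (s : S) (n : ℕ) (s₀ : S) :
    0 ≤ M.avoidProb π s n s₀ := by
  induction n generalizing s₀ with
  | zero => exact zero_le_one
  | succ n ih =>
    unfold avoidProb
    split_ifs
    · exact le_rfl
    · exact Finset.sum_nonneg fun s' _ => mul_nonneg ((M.stateKernel_mem hπ s₀).1 s') (ih s')

theorem avoidProb_le_one (M : MDP S A) {π : S → A → ℝ} (hπ : IsPolicy π) (s : S) (n : ℕ) (s₀ : S) :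
    M.avoidProb π s n s₀ ≤ 1 := by
  induction n generalizing s₀ with
  | zero => exact le_rfl
  | succ n ih =>
    unfold avoidProb
    split_ifs
    · exact zero_le_one
    · exact sum_mul_le_of_mem_stdSimplex (M.stateKernel_mem hπ s₀) ih

/-- A sequence of functions that satisfies the recursion of first-visit estimation of `q`. -/
theorem firstVisit_bias (M : MDP S A) {π : S → A → ℝ} (hπ : IsPolicy π) {s : S} {q : ℝ}
    {U : ℕ → S → ℝ} (hq0 : 0 ≤ q) (hq : q ≤ 1 / (1 - M.γ)) (h0 : ∀ s₀, U 0 s₀ = 0)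
    (hs : ∀ n, U (n + 1) s ≤ q) (hs' : ∀ n, q ≤ U (n + 1) s + M.γ ^ (n + 1) / (1 - M.γ))
    (hne : ∀ n s₀, s₀ ≠ s → U (n + 1) s₀ = ∑ s', M.stateKernel π s₀ s' * U n s') (n : ℕ) (s₀ : S) :
    U n s₀ ≤ q ∧ q ≤ U n s₀ + M.visitBias π s n s₀ := by
  induction n generalizing s₀ with
  | zero => simpa [h0, visitBias, avoidProb, hq0] using hq
  | succ n ih =>
    have hγ := M.one_sub_γ_pos
    have hγ0 := M.γ_pos
    by_cases h : s₀ = s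
    · subst h
      refine ⟨hs n, (hs' n).trans ?_⟩
      unfold visitBias
      gcongr
      -- The term `t = 0` is `γ ^ (n + 1)`, exactly the truncation error of a visit at time `0`.
      rw [Finset.sum_range_succ']
      have h1 : 0 ≤ ∑ i ∈ Finset.range n, M.avoidProb π s₀ (i + 1) s₀ * M.γ ^ (n + 1 - (i + 1)) :=
        Finset.sum_nonneg fun t _ => mul_nonneg (M.avoidProb_nonneg hπ _ _ _) (by positivity)
      have h2 := M.avoidProb_nonneg hπ s₀ (n + 1) s₀
      have h3 : M.avoidProb π s₀ 0 s₀ = 1 := rfl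
      rw [h3, Nat.sub_zero, one_mul]
      linarith
    · have hK := M.stateKernel_mem hπ s₀
      rw [hne n s₀ h]
      refine ⟨sum_mul_le_of_mem_stdSimplex hK fun s' => (ih s').1, ?_⟩
      have h1 : M.avoidProb π s 0 s₀ = 1 := rfl
      have h2 : ∀ t, M.avoidProb π s (t + 1) s₀ =
          ∑ s', M.stateKernel π s₀ s' * M.avoidProb π s t s' := fun t => by
        simp only [avoidProb, if_neg h]
      -- Averaging over the first step shifts `t` to `t + 1` and keeps the remaining horizon `n -
      -- t`; the surplus term `t = 0` is nonnegative.
      have h3 : ∑ s', M.stateKernel π s₀ s' * M.visitBias π s n s' ≤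
          M.visitBias π s (n + 1) s₀ := by
        unfold visitBias
        simp only [← mul_div_assoc]
        rw [← Finset.sum_div]
        gcongr
        rw [Finset.sum_range_succ', h2 n]
        simp only [mul_add, Finset.sum_add_distrib, Finset.mul_sum, h2]
        rw [Finset.sum_comm]
        simp only [Finset.sum_mul, h1, Nat.add_sub_add_right, ← mul_assoc]
        have : 0 ≤ M.γ ^ (n + 1 - 0) := by positivity
        linarith
      calc q = ∑ s', M.stateKernel π s₀ s' * q := (sum_mul_const_of_mem_stdSimplex q hK).symm
        _ ≤ ∑ s', M.stateKernel π s₀ s' * (U n s' + M.visitBias π s n s') :=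
          Finset.sum_le_sum fun s' _ => mul_le_mul_of_nonneg_left (ih s').2 (hK.1 s')
        _ ≤ _ := by
          simp only [mul_add, Finset.sum_add_distrib]
          linarith

theorem trajExp_omcValue_bias (M : MDP S A) {π : S → A → ℝ} (hπ : IsPolicy π) (n : ℕ) (s₀ s : S) :
    M.trajExp π n s₀ (fun z => omcValue M z s) ≤ M.value π s ∧
      M.value π s ≤ M.trajExp π n s₀ (fun z => omcValue M z s) + M.visitBias π s n s₀ := by
  classical
  have hs : ∀ n, M.trajExp π (n + 1) s (fun z => omcValue M z s) = M.truncValue π (n + 1) s := by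
    intro n
    rw [← trajExp_discountedCost M hπ, trajExp, trajExp]
    simp only [omcValue_cons, discountedCost_cons, if_true]
  refine M.firstVisit_bias hπ (U := fun n s₀ => M.trajExp π n s₀ (fun z => omcValue M z s))
    (M.value_nonneg hπ s) (M.value_le hπ s) ?_ ?_ ?_ ?_ n s₀
  · intro s₀
    simp [trajExp, omcValue]
  · intro n
    rw [hs]
    exact M.truncValue_le hπ _ s
  · intro n
    rw [hs]
    exact M.value_le_truncValue_add hπ _ s
  · intro n s₀ h
    exact M.trajExp_succ_of_ne h fun p z hp => by rw [omcValue_cons, if_neg hp]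

/-- At `s` the weighted return has mean `lookahead` of the value truncated after `n` steps, so the
truncation error is `γ · γ ^ n / (1 - γ)`, as `firstVisit_bias` requires. -/
theorem trajExp_monteCarlo_bias (M : MDP S A) {π : S → A → ℝ} (hπ : IsPolicy π) (n : ℕ)
    (s₀ s : S) (a : A) (ha : π s a ≠ 0) :
    M.trajExp π n s₀ (fun z => firstActionInd z s a / π s a * omcValue M z s) ≤
        M.lookahead (M.value π) s a ∧
      M.lookahead (M.value π) s a ≤
        M.trajExp π n s₀ (fun z => firstActionInd z s a / π s a * omcValue M z s) +
          M.visitBias π s n s₀ := by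
  classical
  have hs : ∀ n, M.trajExp π (n + 1) s
      (fun z => firstActionInd z s a / π s a * omcValue M z s) =
        M.lookahead (M.truncValue π n) s a := by
    intro n
    rw [M.trajExp_succ_weight hπ s a
      (fun _ a' z => M.c s a' / π s a + M.γ / π s a * discountedCost M z) fun a' z => by
        rw [firstActionInd_cons, omcValue_cons, if_pos rfl, if_pos rfl]; ring]
    have h : ∀ s', M.trajExp π n s' (fun z => discountedCost M z) = M.truncValue π n s' :=
      M.trajExp_discountedCost hπ n
    simp only [trajExp_const_add_mul M hπ, h, mul_add, Finset.sum_add_distrib,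
      sum_mul_const_of_mem_stdSimplex _ (M.P_mem s a), lookahead, Finset.mul_sum]
    rw [mul_div_cancel₀ _ ha]
    congr 1
    refine Finset.sum_congr rfl fun s' _ => ?_
    field_simp
  refine M.firstVisit_bias hπ
    (U := fun n s₀ => M.trajExp π n s₀ (fun z => firstActionInd z s a / π s a * omcValue M z s))
    (M.lookahead_nonneg (M.value_nonneg hπ) s a) (M.lookahead_le (M.value_le hπ) s a) ?_ ?_ ?_ ?_
    n s₀
  · intro s₀
    simp [trajExp, omcValue]
  · intro n
    rw [hs]
    exact M.lookahead_le_lookahead (M.truncValue_le hπ n) s a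
  · intro n
    rw [hs]
    refine (M.lookahead_le_lookahead (M.value_le_truncValue_add hπ n) s a).trans ?_
    rw [lookahead_add_const, pow_succ']
    exact le_of_eq (by ring)
  · intro n s₀ h
    exact M.trajExp_succ_of_ne h fun p z hp => by
      rw [firstActionInd_cons, omcValue_cons, if_neg hp, if_neg hp]

end MDP

/-! ### The mixing time and geometric estimates -/

section MixingTime

theorem tMix_pos (C ρ νlow : ℝ) : 0 < tMix C ρ νlow :=
  lt_of_lt_of_le one_pos (le_max_left _ _)

theorem mul_pow_tMix_le {C ρ νlow : ℝ} (hC : 0 < C) (hρ : 0 < ρ) (hρ1 : ρ < 1) (hν : 0 < νlow) :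
    C * ρ ^ (tMix C ρ νlow + 1) ≤ νlow / 2 := by
  have h1 : Real.logb ρ (νlow / (2 * C)) ≤ (tMix C ρ νlow : ℕ) :=
    (Nat.le_ceil _).trans (Nat.cast_le.2 (le_max_right _ _))
  have h2 : ρ ^ (tMix C ρ νlow) ≤ νlow / (2 * C) := by
    rw [← Real.rpow_natCast]
    refine (Real.rpow_le_rpow_of_exponent_ge hρ hρ1.le h1).trans ?_
    rw [Real.rpow_logb hρ hρ1.ne (by positivity)]
  calc C * ρ ^ (tMix C ρ νlow + 1) ≤ C * (νlow / (2 * C)) := by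
        refine mul_le_mul_of_nonneg_left (le_trans ?_ h2) hC.le
        exact pow_le_pow_of_le_one hρ.le hρ1.le (Nat.le_succ _)
    _ = νlow / 2 := by field_simp

/-- Bernoulli's inequality gives `1 - x ≤ (1 - x/m)^m`, which converts decay per block of `m` steps
into decay per step. -/
theorem pow_ceil_div_le {x : ℝ} (hx0 : 0 ≤ x) (hx : x ≤ 1) {m : ℕ} (hm : 0 < m) (n : ℕ) :
    (1 - x) ^ ⌈(n : ℝ) / m⌉₊ ≤ (1 - x / m) ^ n := by
  have hm' : (1 : ℝ) ≤ m := by exact_mod_cast hm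
  have hxm : x / m ≤ 1 := (div_le_self hx0 hm').trans hx
  have hq1 : 1 - x / m ≤ 1 := by linarith [div_nonneg hx0 (zero_le_one.trans hm')]
  have h1 : 1 - x ≤ (1 - x / m) ^ m := by
    have := one_add_mul_le_pow (a := -(x / m)) (by linarith) m
    have h2 : (m : ℝ) * (x / m) = x := by field_simp
    calc 1 - x = 1 + m * -(x / m) := by rw [mul_neg, h2]; ring
      _ ≤ _ := by rw [sub_eq_add_neg]; exact this
  have h3 : n ≤ m * ⌈(n : ℝ) / m⌉₊ := by
    have := Nat.le_ceil ((n : ℝ) / m)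
    rw [div_le_iff₀ (by linarith)] at this
    rw [mul_comm]
    exact_mod_cast this
  calc (1 - x) ^ ⌈(n : ℝ) / m⌉₊ ≤ ((1 - x / m) ^ m) ^ ⌈(n : ℝ) / m⌉₊ :=
        pow_le_pow_left₀ (by linarith) h1 _
    _ = (1 - x / m) ^ (m * ⌈(n : ℝ) / m⌉₊) := (pow_mul _ _ _).symm
    _ ≤ (1 - x / m) ^ n := pow_le_pow_of_le_one (by linarith) hq1 h3

theorem pow_mul_pow_sub_le_add {a b : ℝ} (ha : 0 ≤ a) (hb : 0 ≤ b) {t n : ℕ} (h : t ≤ n) :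
    a ^ t * b ^ (n - t) ≤ a ^ n + b ^ n := by
  rcases le_total a b with hab | hab
  · calc a ^ t * b ^ (n - t) ≤ b ^ t * b ^ (n - t) := by gcongr
      _ = b ^ n := by rw [← pow_add, Nat.add_sub_cancel' h]
      _ ≤ _ := le_add_of_nonneg_left (by positivity)
  · calc a ^ t * b ^ (n - t) ≤ a ^ t * a ^ (n - t) := by gcongr
      _ = a ^ n := by rw [← pow_add, Nat.add_sub_cancel' h]
      _ ≤ _ := le_add_of_nonneg_right (by positivity)

end MixingTime

/-! ### Avoidance probabilities under mixing -/

namespace MDP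

variable {S A : Type*} [Fintype S] [Fintype A]

theorem Mixes.νlow_le_one {M : MDP S A} {π : S → A → ℝ} {C ρ νlow : ℝ}
    (h : M.Mixes π C ρ νlow) (s : S) : νlow ≤ 1 := by
  obtain ⟨ν, hν, -, -, hlow⟩ := h
  exact (hlow s).trans (hν.2 ▸ Finset.single_le_sum (fun s _ => hν.1 s) (Finset.mem_univ s))

/-- At time `tMix` the total deviation from stationarity is at most `νlow / 2`, half of the smallest
stationary mass. -/
theorem Mixes.le_stateDist_tMix {M : MDP S A} {π : S → A → ℝ} {C ρ νlow : ℝ}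
    (h : M.Mixes π C ρ νlow) (hC : 0 < C) (hρ : 0 < ρ) (hρ1 : ρ < 1) (hν : 0 < νlow) (s₀ s : S) :
    νlow / 2 ≤ M.stateDist π s₀ (tMix C ρ νlow) s := by
  obtain ⟨ν, -, -, hmix, hlow⟩ := h
  have h1 := (Finset.single_le_sum
    (f := fun s => |M.stateDist π s₀ (tMix C ρ νlow) s - ν s|) (fun s _ => abs_nonneg _)
    (Finset.mem_univ s)).trans ((hmix s₀ _).trans (mul_pow_tMix_le hC hρ hρ1 hν))
  have h2 := (abs_le.1 h1).1
  linarith [hlow s]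

theorem avoidProb_succ_le (M : MDP S A) {π : S → A → ℝ} (hπ : IsPolicy π) (s : S) (n : ℕ) (s₀ : S) :
    M.avoidProb π s (n + 1) s₀ ≤ ∑ s', M.stateKernel π s₀ s' * M.avoidProb π s n s' := by
  rw [avoidProb]
  dsimp only
  split_ifs
  · exact Finset.sum_nonneg fun s' _ =>
      mul_nonneg ((M.stateKernel_mem hπ s₀).1 s') (M.avoidProb_nonneg hπ s n s')
  · exact le_rfl

theorem avoidProb_antitone (M : MDP S A) {π : S → A → ℝ} (hπ : IsPolicy π) (s s₀ : S) :
    Antitone fun n => M.avoidProb π s n s₀ := by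
  refine antitone_nat_of_succ_le fun n => ?_
  induction n generalizing s₀ with
  | zero => exact M.avoidProb_le_one hπ s 1 s₀
  | succ n ih =>
    rw [avoidProb, avoidProb]
    dsimp only
    split_ifs
    · exact le_rfl
    · exact Finset.sum_le_sum fun s' _ =>
        mul_le_mul_of_nonneg_left (ih s') ((M.stateKernel_mem hπ s₀).1 s')

/-- Drops the requirement that `s` be avoided during the first `m` steps. -/
theorem avoidProb_add_le (M : MDP S A) {π : S → A → ℝ} (hπ : IsPolicy π) (s : S) (j m : ℕ) (s₀ : S) :
    M.avoidProb π s (j + m) s₀ ≤ ∑ s', M.stateDist π s₀ m s' * M.avoidProb π s j s' := by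
  classical
  induction m generalizing s₀ with
  | zero => simp [stateDist]
  | succ m ih =>
    rw [sum_stateDist_succ_mul]
    exact (M.avoidProb_succ_le hπ s (j + m) s₀).trans (Finset.sum_le_sum fun s' _ =>
      mul_le_mul_of_nonneg_left (ih s') ((M.stateKernel_mem hπ s₀).1 s'))

theorem avoidProb_succ_self (M : MDP S A) (π : S → A → ℝ) (s : S) (n : ℕ) :
    M.avoidProb π s (n + 1) s = 0 := by
  simp [avoidProb]

/-- After each block the chain is at `s` with probability at least `νlow / 2`, and those paths
contribute nothing to avoidance. The extra step in the horizon makes this true at the end of the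
last block too, since `avoidProb` at `s` vanishes only for positive horizons. -/
theorem Mixes.avoidProb_le_pow {M : MDP S A} {π : S → A → ℝ} {C ρ νlow : ℝ}
    (h : M.Mixes π C ρ νlow) (hπ : IsPolicy π) (hC : 0 < C) (hρ : 0 < ρ) (hρ1 : ρ < 1)
    (hν : 0 < νlow) (s : S) (i : ℕ) (s₀ : S) :
    M.avoidProb π s (i * tMix C ρ νlow + 1) s₀ ≤ (1 - νlow / 2) ^ i := by
  classical
  induction i generalizing s₀ with
  | zero => simpa using M.avoidProb_le_one hπ s 1 s₀
  | succ i ih =>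
    have hb : 0 ≤ (1 - νlow / 2) ^ i := pow_nonneg (by linarith [h.νlow_le_one s]) i
    have hd := M.stateDist_mem hπ s₀ (tMix C ρ νlow)
    have h1 := M.avoidProb_add_le hπ s (i * tMix C ρ νlow + 1) (tMix C ρ νlow) s₀
    rw [show (i + 1) * tMix C ρ νlow + 1 = i * tMix C ρ νlow + 1 + tMix C ρ νlow by ring]
    refine h1.trans ?_
    calc ∑ s', M.stateDist π s₀ (tMix C ρ νlow) s' * M.avoidProb π s (i * tMix C ρ νlow + 1) s'
        ≤ ∑ s', (M.stateDist π s₀ (tMix C ρ νlow) s' * (1 - νlow / 2) ^ i -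
            if s' = s then M.stateDist π s₀ (tMix C ρ νlow) s * (1 - νlow / 2) ^ i else 0) := by
          refine Finset.sum_le_sum fun s' _ => ?_
          split_ifs with hs
          · rw [hs, M.avoidProb_succ_self]; simp
          · rw [sub_zero]
            exact mul_le_mul_of_nonneg_left (ih s') (hd.1 s')
      _ = (1 - M.stateDist π s₀ (tMix C ρ νlow) s) * (1 - νlow / 2) ^ i := by
          rw [Finset.sum_sub_distrib, sum_mul_const_of_mem_stdSimplex _ hd]
          simp
          ring
      _ ≤ (1 - νlow / 2) * (1 - νlow / 2) ^ i := by
          gcongr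
          exact h.le_stateDist_tMix hC hρ hρ1 hν s₀ s
      _ = _ := (pow_succ' _ _).symm

theorem Mixes.avoidProb_le {M : MDP S A} {π : S → A → ℝ} {C ρ νlow : ℝ}
    (h : M.Mixes π C ρ νlow) (hπ : IsPolicy π) (hC : 0 < C) (hρ : 0 < ρ) (hρ1 : ρ < 1)
    (hν : 0 < νlow) (s : S) (n : ℕ) (s₀ : S) :
    M.avoidProb π s n s₀ ≤ 2 * (1 - νlow / 2) ^ ⌈(n : ℝ) / tMix C ρ νlow⌉₊ := by
  have hν1 := h.νlow_le_one s
  have hm : (0 : ℝ) < tMix C ρ νlow := by exact_mod_cast tMix_pos C ρ νlow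
  rcases hc : ⌈(n : ℝ) / tMix C ρ νlow⌉₊ with _ | c
  · rw [pow_zero]
    linarith [M.avoidProb_le_one hπ s n s₀]
  -- With `c + 1` the ceiling, `c` full blocks and one more step fit into `n`. The lost factor `1 -
  -- νlow / 2 ≥ 1/2` is paid for by the constant `2`.
  · have h1 : c * tMix C ρ νlow + 1 ≤ n := by
      have : (c : ℝ) < n / tMix C ρ νlow := Nat.lt_ceil.1 (hc ▸ Nat.lt_succ_self c)
      rw [lt_div_iff₀ hm] at this
      exact_mod_cast this
    have h2 : 0 ≤ (1 - νlow / 2) ^ c := pow_nonneg (by linarith) c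
    calc M.avoidProb π s n s₀ ≤ M.avoidProb π s (c * tMix C ρ νlow + 1) s₀ :=
          M.avoidProb_antitone hπ s s₀ h1
      _ ≤ (1 - νlow / 2) ^ c := h.avoidProb_le_pow hπ hC hρ hρ1 hν s c s₀
      _ ≤ _ := by
          rw [pow_succ]
          nlinarith

/-- Each term is a product of two geometric decays over complementary times, hence at most the sum
of the two decays over the full time `n`. -/
theorem Mixes.visitBias_le {M : MDP S A} {π : S → A → ℝ} {C ρ νlow : ℝ}
    (h : M.Mixes π C ρ νlow) (hπ : IsPolicy π) (hC : 0 < C) (hρ : 0 < ρ) (hρ1 : ρ < 1)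
    (hν : 0 < νlow) (s : S) (n : ℕ) (s₀ : S) :
    M.visitBias π s n s₀ ≤
      (2 * n * (M.γ ^ (n - 1) + (1 - νlow / (2 * tMix C ρ νlow)) ^ (n - 1)) +
        2 * (1 - νlow / 2) ^ ⌈(n : ℝ) / tMix C ρ νlow⌉₊) / (1 - M.γ) := by
  have hν1 := h.νlow_le_one s
  have hγ := M.one_sub_γ_pos
  have hγ0 := M.γ_pos
  have hm : (1 : ℝ) ≤ tMix C ρ νlow := by exact_mod_cast tMix_pos C ρ νlow
  set q := 1 - νlow / (2 * tMix C ρ νlow) with hq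
  have hq' : q = 1 - νlow / 2 / tMix C ρ νlow := by rw [hq, div_div]
  have hx : νlow / 2 / tMix C ρ νlow ≤ νlow / 2 := div_le_self (by linarith) hm
  have hq0 : 0 ≤ q := by linarith
  have hq1 : q ≤ 1 := by
    have : 0 ≤ νlow / 2 / tMix C ρ νlow := by positivity
    linarith
  unfold visitBias
  gcongr
  · calc ∑ t ∈ Finset.range n, M.avoidProb π s t s₀ * M.γ ^ (n - t)
        ≤ ∑ t ∈ Finset.range n, 2 * (M.γ ^ (n - 1) + q ^ (n - 1)) := by
          refine Finset.sum_le_sum fun t ht => ?_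
          have htn : t ≤ n := (Finset.mem_range.1 ht).le
          have h1 : M.avoidProb π s t s₀ ≤ 2 * q ^ t := by
            refine (h.avoidProb_le hπ hC hρ hρ1 hν s t s₀).trans ?_
            rw [hq']
            have := pow_ceil_div_le (x := νlow / 2) (by linarith) (by linarith)
              (tMix_pos C ρ νlow) t
            linarith
          calc M.avoidProb π s t s₀ * M.γ ^ (n - t) ≤ 2 * q ^ t * M.γ ^ (n - t) := by gcongr
            _ = 2 * (q ^ t * M.γ ^ (n - t)) := by ring
            _ ≤ 2 * (q ^ n + M.γ ^ n) := by
              gcongr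
              exact pow_mul_pow_sub_le_add hq0 hγ0.le htn
            _ ≤ 2 * (q ^ (n - 1) + M.γ ^ (n - 1)) := by
              gcongr 2 * (?_ + ?_)
              · exact pow_le_pow_of_le_one hq0 hq1 (Nat.sub_le _ _)
              · exact pow_le_pow_of_le_one hγ0.le M.γ_lt_one.le (Nat.sub_le _ _)
            _ = _ := by ring
      _ = _ := by
          rw [Finset.sum_const, Finset.card_range, nsmul_eq_mul]
          ring
  · exact h.avoidProb_le hπ hC hρ hρ1 hν s n s₀

/-- Two states and two starting points occur because VBE-I estimates the value at the successor on
one trajectory and visits `s` on the other. -/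
theorem Mixes.visitBias_add_le_vbeBias {M : MDP S A} {π : S → A → ℝ} {C ρ νlow : ℝ}
    (h : M.Mixes π C ρ νlow) (hπ : IsPolicy π) (hC : 0 < C) (hρ : 0 < ρ) (hρ1 : ρ < 1)
    (hν : 0 < νlow) (n : ℕ) (s s' : S)
    (s₀ s₀' : S) :
    M.visitBias π s n s₀ + M.avoidProb π s' n s₀' / (1 - M.γ) ≤ vbeBias M.γ C ρ νlow n := by
  have hν1 := h.νlow_le_one s
  have hγ := M.one_sub_γ_pos
  have hγ0 := M.γ_pos
  have h1 := h.visitBias_le hπ hC hρ hρ1 hν s n s₀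
  have h2 := h.avoidProb_le hπ hC hρ hρ1 hν s' n s₀'
  have hm : (1 : ℝ) ≤ tMix C ρ νlow := by exact_mod_cast tMix_pos C ρ νlow
  have hx : νlow / (2 * tMix C ρ νlow) ≤ 1 := by
    rw [div_le_one (by positivity)]
    linarith
  have hX : 0 ≤ M.γ ^ (n - 1) + (1 - νlow / (2 * tMix C ρ νlow)) ^ (n - 1) :=
    add_nonneg (by positivity) (pow_nonneg (by linarith) _)
  have hY : 0 ≤ (1 - νlow / 2) ^ ⌈(n : ℝ) / tMix C ρ νlow⌉₊ := pow_nonneg (by linarith) _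
  unfold vbeBias
  set X := M.γ ^ (n - 1) + (1 - νlow / (2 * tMix C ρ νlow)) ^ (n - 1)
  set Y := (1 - νlow / 2) ^ ⌈(n : ℝ) / tMix C ρ νlow⌉₊
  calc M.visitBias π s n s₀ + M.avoidProb π s' n s₀' / (1 - M.γ)
      ≤ (2 * n * X + 2 * Y) / (1 - M.γ) + 2 * Y / (1 - M.γ) := by gcongr
    _ = (2 * n * X + 4 * Y) / (1 - M.γ) := by ring
    _ ≤ (4 * (n + 1) * X + 8 * Y) / (1 - M.γ) := by
        gcongr ?_ / _
        have : (0 : ℝ) ≤ n := n.cast_nonneg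
        nlinarith [mul_nonneg this hX]
    _ = _ := by ring

end MDP

/-! ### Second moment and bias of VBE-I and VBE-II -/

section EvaluationOperator

open Classical in
/-- The expectation of `g` of a sample, given that it starts as `y₀`. -/
noncomputable def EvalOp.startExp {S A : Type*} (E : EvalOp S A) [Fintype E.Sample]
    (p : S → A → ℝ) (y₀ : E.Sample) (g : E.Sample → ℝ) : ℝ :=
  ∑ y, if E.sameStart y₀ y then E.prob p y * g y else 0

theorem EvalOp.startExp_sum {S A ι : Type*} (E : EvalOp S A) [Fintype E.Sample]
    (p : S → A → ℝ) (y₀ : E.Sample) (I : Finset ι) (g : ι → E.Sample → ℝ) :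
    E.startExp p y₀ (fun y => ∑ i ∈ I, g i y) = ∑ i ∈ I, E.startExp p y₀ (g i) := by
  unfold startExp
  rw [Finset.sum_comm]
  refine Finset.sum_congr rfl fun y _ => ?_
  split_ifs
  · rw [Finset.mul_sum]
  · rw [Finset.sum_const_zero]

theorem EvalOp.startExp_sub_mul {S A : Type*} (E : EvalOp S A) [Fintype E.Sample]
    (p : S → A → ℝ) (y₀ : E.Sample) (c d : ℝ) (g : E.Sample → ℝ) :
    E.startExp p y₀ (fun y => (c - g y) * d) =
      (c * E.startExp p y₀ (fun _ => 1) - E.startExp p y₀ g) * d := by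
  unfold startExp
  rw [Finset.mul_sum, ← Finset.sum_sub_distrib, Finset.sum_mul]
  refine Finset.sum_congr rfl fun y _ => ?_
  split_ifs <;> ring

variable {S A : Type*} [Fintype S] [Fintype A]

noncomputable instance (M : MDP S A) (n : ℕ) : Fintype (vbeI M n).Sample :=
  inferInstanceAs (Fintype ((Fin n → S × A) × (Fin (n + 1) → S × A)))

noncomputable instance (M : MDP S A) (n : ℕ) : Fintype (vbeII M n).Sample :=
  inferInstanceAs (Fintype (Fin (n + 1) → S × A))

noncomputable instance (V : VBEVariant) (M : MDP S A) (n : ℕ) : Fintype (vbe V M n).Sample :=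
  match V with
  | VBEVariant.I => inferInstanceAs (Fintype (vbeI M n).Sample)
  | VBEVariant.II => inferInstanceAs (Fintype (vbeII M n).Sample)

theorem startExp_vbeI (M : MDP S A) {n : ℕ} (π : S → A → ℝ) (y₀ : (vbeI M (n + 1)).Sample)
    (g : (vbeI M (n + 1)).Sample → ℝ) :
    (vbeI M (n + 1)).startExp π y₀ g =
      M.trajExp π (n + 1) (y₀.1 0).1 fun zV =>
        M.trajExp π (n + 2) (y₀.2 0).1 fun zQ => g (zV, zQ) := by
  classical
  rw [← MDP.sum_sameStart_trajProb_mul]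
  simp only [← MDP.sum_sameStart_trajProb_mul]
  refine (Fintype.sum_prod_type _).trans (Finset.sum_congr rfl fun zV _ => ?_)
  by_cases h : SameStart y₀.1 zV
  · rw [if_pos h, Finset.mul_sum]
    refine Finset.sum_congr rfl fun zQ _ => ?_
    by_cases h' : SameStart y₀.2 zQ
    · rw [if_pos h', if_pos ⟨h, h'⟩]
      exact mul_assoc _ _ _
    · rw [if_neg h', mul_zero, if_neg fun h'' => h' h''.2]
  · rw [if_neg h]
    exact Finset.sum_eq_zero fun zQ _ => if_neg fun h'' => h h''.1

theorem startExp_vbeII (M : MDP S A) {n : ℕ} (π : S → A → ℝ) (y₀ : (vbeII M n).Sample)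
    (g : (vbeII M n).Sample → ℝ) :
    (vbeII M n).startExp π y₀ g = M.trajExp π (n + 1) (y₀ 0).1 g := by
  classical
  exact M.sum_sameStart_trajProb_mul π y₀ g

theorem vbe_estimate_nonneg (V : VBEVariant) (M : MDP S A) (n : ℕ) {π : S → A → ℝ}
    (hπ0 : ∀ s a, 0 < π s a) (ξ : (vbe V M n).Sample) (s : S) (a : A) :
    0 ≤ (vbe V M n).estimate π ξ s a := by
  cases V with
  | I =>
    obtain ⟨s', h⟩ := exists_bootstrapEstimate_eq M (omcValue M ξ.1) (π s a) ξ.2 s a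
    change 0 ≤ bootstrapEstimate M (omcValue M ξ.1) (π s a) ξ.2 s a
    rw [h]
    exact mul_nonneg (div_nonneg (firstActionInd_nonneg _ s a) (hπ0 s a).le)
      (add_nonneg (M.c_nonneg s a) (mul_nonneg M.γ_pos.le (omcValue_nonneg M _ _)))
  | II =>
    refine le_of_le_of_eq ?_ (vbeIIEstimate_eq M π ξ s a).symm
    exact mul_nonneg (div_nonneg (firstActionInd_nonneg _ s a) (hπ0 s a).le)
      (omcValue_nonneg M _ _)

theorem startExp_vbe_one (V : VBEVariant) (M : MDP S A) {n : ℕ} (hn : 0 < n) {π : S → A → ℝ}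
    (hπ : IsPolicy π) (y₀ : (vbe V M n).Sample) :
    (vbe V M n).startExp π y₀ (fun _ => 1) = 1 := by
  obtain ⟨n, rfl⟩ := Nat.exists_eq_succ_of_ne_zero hn.ne'
  cases V with
  | I =>
    refine (startExp_vbeI M π y₀ _).trans ?_
    simp only [M.trajExp_const hπ]
  | II =>
    refine (startExp_vbeII M π y₀ _).trans ?_
    exact M.trajExp_const hπ _ _ _

theorem mul_div_mul_sq_le {w i y b : ℝ} (hw : 0 < w) (hi : 0 ≤ i) (hi2 : i ^ 2 = i) (hy : 0 ≤ y)
    (hyb : y ≤ b) : w * (i / w * y) ^ 2 ≤ b ^ 2 / w * i := by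
  calc w * (i / w * y) ^ 2 = i ^ 2 * y ^ 2 / w := by field_simp
    _ = i / w * y ^ 2 := by rw [hi2]; ring
    _ ≤ i / w * b ^ 2 := by gcongr
    _ = _ := by ring

theorem trajExp_mul_firstActionInd_le (M : MDP S A) {π : S → A → ℝ} (hπ : IsPolicy π)
    (n : ℕ) (s₀ s : S) (a : A) (ha : 0 < π s a) (b : ℝ) :
    M.trajExp π (n + 1) s₀
      (fun z => b ^ 2 / π s a * firstActionInd (fun i : Fin n => z i.castSucc) s a) ≤ b ^ 2 := by
  rw [M.trajExp_const_mul hπ,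
    M.trajExp_castSucc hπ n s₀ (fun z : Fin n → S × A => firstActionInd z s a),
    M.trajExp_firstActionInd hπ]
  have := M.avoidProb_nonneg hπ s n s₀
  calc b ^ 2 / π s a * (π s a * (1 - M.avoidProb π s n s₀))
      = b ^ 2 * (1 - M.avoidProb π s n s₀) := by field_simp
    _ ≤ b ^ 2 * 1 := by gcongr; linarith
    _ = b ^ 2 := mul_one _

/-- Squaring gives `1 / π²`, the prefactor `π` cancels one power, and the probability of the first
action, at most `π`, cancels the other. The remaining factor of the estimate is at most `1 / (1 -
γ)`. -/
theorem startExp_vbe_sq_le (V : VBEVariant) (M : MDP S A) {n : ℕ} (hn : 0 < n) {π : S → A → ℝ}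
    (hπ : IsPolicy π) (hπ0 : ∀ s a, 0 < π s a) (y₀ : (vbe V M n).Sample) (s : S) (a : A) :
    (vbe V M n).startExp π y₀ (fun y => π s a * (vbe V M n).estimate π y s a ^ 2) ≤
      (1 / (1 - M.γ)) ^ 2 := by
  obtain ⟨n, rfl⟩ := Nat.exists_eq_succ_of_ne_zero hn.ne'
  cases V with
  | I =>
    refine (startExp_vbeI M π y₀ _).trans_le ?_
    refine le_trans (M.trajExp_mono hπ _ _ fun zV => ?_)
      (M.trajExp_const hπ (n + 1) _ ((1 / (1 - M.γ)) ^ 2)).le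
    refine le_trans (M.trajExp_mono hπ _ _ fun zQ => ?_)
      (trajExp_mul_firstActionInd_le M hπ (n + 1) _ s a (hπ0 s a) (1 / (1 - M.γ)))
    obtain ⟨s', h⟩ := exists_bootstrapEstimate_eq M (omcValue M zV) (π s a) zQ s a
    change π s a * bootstrapEstimate M (omcValue M zV) (π s a) zQ s a ^ 2 ≤ _
    rw [h]
    refine mul_div_mul_sq_le (hπ0 s a) (firstActionInd_nonneg _ s a) (firstActionInd_sq _ s a)
      (add_nonneg (M.c_nonneg s a) (mul_nonneg M.γ_pos.le (omcValue_nonneg M _ _))) ?_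
    rw [← M.one_add_γ_mul]
    exact add_le_add (M.c_le_one s a)
      (mul_le_mul_of_nonneg_left (omcValue_le M _ _) M.γ_pos.le)
  | II =>
    refine (startExp_vbeII M π y₀ _).trans_le ?_
    refine le_trans (M.trajExp_mono hπ _ _ fun z => ?_)
      (trajExp_mul_firstActionInd_le M hπ (n + 1) _ s a (hπ0 s a) (1 / (1 - M.γ)))
    change π s a * vbeIIEstimate M π z s a ^ 2 ≤ _
    rw [vbeIIEstimate_eq]
    exact mul_div_mul_sq_le (hπ0 s a) (firstActionInd_nonneg _ s a) (firstActionInd_sq _ s a)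
      (omcValue_nonneg M _ _) (omcValue_le M _ _)

theorem trajExp_lookahead (M : MDP S A) {π : S → A → ℝ} (hπ : IsPolicy π) (n : ℕ) (s₀ s : S) (a : A)
    (f : (Fin n → S × A) → S → ℝ) :
    M.trajExp π n s₀ (fun z => M.lookahead (f z) s a) =
      M.lookahead (fun s' => M.trajExp π n s₀ fun z => f z s') s a := by
  unfold MDP.lookahead
  rw [M.trajExp_const_add_mul hπ, MDP.trajExp_sum]
  simp only [M.trajExp_const_mul hπ]

theorem startExp_vbe_bias (V : VBEVariant) (M : MDP S A) {n : ℕ} (hn : 0 < n) {π : S → A → ℝ}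
    (hπ : IsPolicy π) (hπ0 : ∀ s a, 0 < π s a) {C ρ νlow : ℝ} (hC : 0 < C) (hρ : 0 < ρ)
    (hρ1 : ρ < 1) (hν : 0 < νlow) (hmix : M.Mixes π C ρ νlow) (y₀ : (vbe V M n).Sample)
    (s : S) (a : A) :
    (vbe V M n).startExp π y₀ (fun y => (vbe V M n).estimate π y s a) ≤
        M.lookahead (M.value π) s a ∧
      M.lookahead (M.value π) s a ≤
        (vbe V M n).startExp π y₀ (fun y => (vbe V M n).estimate π y s a) +
          vbeBias M.γ C ρ νlow n := by
  obtain ⟨n, rfl⟩ := Nat.exists_eq_succ_of_ne_zero hn.ne'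
  have hγ := M.one_sub_γ_pos
  cases V with
  | I =>
    have h : (vbe VBEVariant.I M (n + 1)).startExp π y₀
        (fun y => (vbe VBEVariant.I M (n + 1)).estimate π y s a) =
        (1 - M.avoidProb π s (n + 1) (y₀.2 0).1) *
          M.lookahead (fun s' => M.trajExp π (n + 1) (y₀.1 0).1 fun z => omcValue M z s') s a := by
      refine (startExp_vbeI M π y₀ _).trans ?_
      have : ∀ zV : Fin (n + 1) → S × A, M.trajExp π (n + 2) (y₀.2 0).1
          (fun zQ => bootstrapEstimate M (omcValue M zV) (π s a) zQ s a) = _ := fun zV =>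
        M.trajExp_bootstrapEstimate hπ (n + 1) (y₀.2 0).1 s a (hπ0 s a).ne' (omcValue M zV)
      change M.trajExp π (n + 1) (y₀.1 0).1 (fun zV => M.trajExp π (n + 2) (y₀.2 0).1
          (fun zQ => bootstrapEstimate M (omcValue M zV) (π s a) zQ s a)) = _
      simp only [this]
      rw [M.trajExp_const_mul hπ, trajExp_lookahead M hπ]
    rw [h]
    set W := fun s' => M.trajExp π (n + 1) (y₀.1 0).1 fun z => omcValue M z s'
    set N := M.avoidProb π s (n + 1) (y₀.2 0).1
    have hN0 : 0 ≤ N := M.avoidProb_nonneg hπ _ _ _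
    have hW0 : ∀ s', 0 ≤ W s' := fun s' => by
      rw [← M.trajExp_const hπ (n + 1) (y₀.1 0).1 0]
      exact M.trajExp_mono hπ _ _ fun z => omcValue_nonneg M z s'
    have hWV : ∀ s', W s' ≤ M.value π s' := fun s' => (M.trajExp_omcValue_bias hπ _ _ s').1
    -- The budget `vbeBias` is split: `N / (1 - γ)` is reserved for the event that the second
    -- trajectory misses `s`, the rest covers the bias of the value estimate, which `lookahead`
    -- contracts by `γ`.
    have hWB : ∀ s', M.value π s' ≤ W s' + (vbeBias M.γ C ρ νlow (n + 1) - N / (1 - M.γ)) :=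
      fun s' => by
        have h1 := (M.trajExp_omcValue_bias hπ (n + 1) (y₀.1 0).1 s').2
        have h2 := hmix.visitBias_add_le_vbeBias hπ hC hρ hρ1 hν (n + 1) s' s (y₀.1 0).1
          (y₀.2 0).1
        linarith
    have hL0 := M.lookahead_nonneg hW0 s a
    have hLV := M.lookahead_le_lookahead hWV s a
    have hL1 : M.lookahead W s a ≤ 1 / (1 - M.γ) :=
      M.lookahead_le (fun s' => (hWV s').trans (M.value_le hπ s')) s a
    have hLB := M.lookahead_le_lookahead hWB s a
    rw [M.lookahead_add_const] at hLB
    have hb : 0 ≤ vbeBias M.γ C ρ νlow (n + 1) - N / (1 - M.γ) := by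
      have := hWV s
      have := hWB s
      linarith
    have hγb : M.γ * (vbeBias M.γ C ρ νlow (n + 1) - N / (1 - M.γ)) ≤
        vbeBias M.γ C ρ νlow (n + 1) - N / (1 - M.γ) :=
      mul_le_of_le_one_left hb M.γ_lt_one.le
    have hNL : N * M.lookahead W s a ≤ N / (1 - M.γ) := by
      rw [div_eq_mul_one_div]
      exact mul_le_mul_of_nonneg_left hL1 hN0
    constructor
    · nlinarith
    · linarith
  | II =>
    have h : (vbe VBEVariant.II M (n + 1)).startExp π y₀
        (fun y => (vbe VBEVariant.II M (n + 1)).estimate π y s a) =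
        M.trajExp π (n + 1) (y₀ 0).1
          (fun z => firstActionInd z s a / π s a * omcValue M z s) := by
      refine (startExp_vbeII M π y₀ _).trans ?_
      rw [← M.trajExp_castSucc hπ]
      congr 1
      ext z
      exact vbeIIEstimate_eq M π z s a
    rw [h]
    have h1 := M.trajExp_monteCarlo_bias hπ (n + 1) (y₀ 0).1 s a (hπ0 s a).ne'
    have h2 := hmix.visitBias_add_le_vbeBias hπ hC hρ hρ1 hν (n + 1) s s (y₀ 0).1 (y₀ 0).1
    have h3 : 0 ≤ M.avoidProb π s (n + 1) (y₀ 0).1 / (1 - M.γ) :=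
      div_nonneg (M.avoidProb_nonneg hπ _ _ _) hγ.le
    exact ⟨h1.1, by linarith⟩

/-- For one-sided errors the `p'` part has a favourable sign and is dropped; hence neither a factor
`2` nor one of the cardinality. -/
theorem sum_mul_sub_le_of_mem_stdSimplex {ι : Type*} [Fintype ι] {p p' d : ι → ℝ} {b : ℝ}
    (hp : p ∈ stdSimplex ℝ ι) (hp' : p' ∈ stdSimplex ℝ ι) (hd0 : ∀ i, 0 ≤ d i)
    (hd : ∀ i, d i ≤ b) : ∑ i, d i * (p i - p' i) ≤ b := by
  have h1 := sum_mul_le_of_mem_stdSimplex hp hd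
  have h2 : 0 ≤ ∑ i, p' i * d i := Finset.sum_nonneg fun i _ => mul_nonneg (hp'.1 i) (hd0 i)
  simp only [mul_comm (d _), sub_mul, Finset.sum_sub_distrib]
  linarith

theorem startExp_vbe_inner_le (V : VBEVariant) (M : MDP S A) {n : ℕ} (hn : 0 < n) {π : S → A → ℝ}
    (hπ : IsPolicy π) (hπ0 : ∀ s a, 0 < π s a) {C ρ νlow : ℝ} (hC : 0 < C) (hρ : 0 < ρ)
    (hρ1 : ρ < 1) (hν : 0 < νlow) (hmix : M.Mixes π C ρ νlow) (y₀ : (vbe V M n).Sample)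
    (s : S) {p : A → ℝ} (hp : p ∈ stdSimplex ℝ A) :
    (vbe V M n).startExp π y₀ (fun y => ∑ a, (M.lookahead (M.value π) s a -
      (vbe V M n).estimate π y s a) * (π s a - p a)) ≤ vbeBias M.γ C ρ νlow n := by
  rw [EvalOp.startExp_sum]
  simp only [EvalOp.startExp_sub_mul, startExp_vbe_one V M hn hπ, mul_one]
  have h := startExp_vbe_bias V M hn hπ hπ0 hC hρ hρ1 hν hmix y₀ s
  exact sum_mul_sub_le_of_mem_stdSimplex (hπ s) hp (fun a => by linarith [(h a).1])
    fun a => by linarith [(h a).2]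

end EvaluationOperator

/-! ### Expectations of functions of finitely valued data -/

section DiscreteData

variable {Ω α : Type*} [MeasurableSpace Ω] [MeasurableSpace α]

theorem integrable_of_finite_range [Finite α] [MeasurableSingletonClass α] {μ : Measure Ω}
    [IsFiniteMeasure μ] {X : Ω → α} (hX : Measurable X) (F : α → ℝ) :
    Integrable (fun ω => F (X ω)) μ :=
  (Integrable.of_finite (μ := μ.map X) (f := F)).comp_measurable hX

theorem integral_eq_sum_of_finite_range [Fintype α] [MeasurableSingletonClass α] {μ : Measure Ω}
    [IsFiniteMeasure μ] {X : Ω → α} (hX : Measurable X) (F : α → ℝ) :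
    ∫ ω, F (X ω) ∂μ = ∑ x, μ.real {ω | X ω = x} * F x := by
  rw [← integral_map (f := F) hX.aemeasurable (measurable_of_finite F).aestronglyMeasurable,
    integral_fintype Integrable.of_finite]
  refine Finset.sum_congr rfl fun x _ => ?_
  rw [map_measureReal_apply hX (measurableSet_singleton x), smul_eq_mul]
  rfl

theorem integral_uniform_index {μ : Measure Ω} [IsProbabilityMeasure μ] [Fintype α]
    [MeasurableSingletonClass α] {k : ℕ} {R : Ω → Fin k} {X : Ω → α} (hR : Measurable R)
    (hX : Measurable X) (hunif : ∀ i, μ.real {ω | R ω = i} = 1 / (k : ℝ)) (hind : IndepFun R X μ)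
    (F : Fin k → α → ℝ) :
    ∫ ω, F (R ω) (X ω) ∂μ = (1 / (k : ℝ)) * ∑ i, ∫ ω, F i (X ω) ∂μ := by
  rw [integral_eq_sum_of_finite_range (hR.prodMk hX) fun z => F z.1 z.2, Fintype.sum_prod_type,
    Finset.mul_sum]
  refine Finset.sum_congr rfl fun i _ => ?_
  rw [integral_eq_sum_of_finite_range hX, Finset.mul_sum]
  refine Finset.sum_congr rfl fun x _ => ?_
  have h := hind.measure_inter_preimage_eq_mul {i} {x} (measurableSet_singleton i)
    (measurableSet_singleton x)
  have h' : μ.real {ω | (R ω, X ω) = (i, x)} = μ.real {ω | R ω = i} * μ.real {ω | X ω = x} := by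
    rw [measureReal_def, measureReal_def, measureReal_def, ← ENNReal.toReal_mul]
    refine congrArg ENNReal.toReal (Eq.trans (congrArg μ ?_) h)
    ext ω
    simp
  rw [h', hunif, mul_assoc]

end DiscreteData

/-! ### The random run of the algorithm -/

section Run

variable {S A : Type*} [Fintype A]

instance (E : EvalOp S A) : DiscreteMeasurableSpace E.Sample := ⟨fun _ => trivial⟩

/-- The policy of mirror descent after the samples `x 0, ..., x (t - 1)`. -/
noncomputable def policyOfSamples (E : EvalOp S A) (η : ℝ) :
    (t : ℕ) → (Fin t → E.Sample) → S → A → ℝ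
  | 0, _ => fun _ _ => 1 / (Fintype.card A : ℝ)
  | t + 1, x => fun s =>
      expWeights η
        (E.estimate (policyOfSamples E η t (fun i => x i.castSucc)) (x (Fin.last t)) s)
        (policyOfSamples E η t (fun i => x i.castSucc) s)

theorem policyOfSamples_pos [Nonempty A] (E : EvalOp S A) (η : ℝ) (t : ℕ) (x : Fin t → E.Sample)
    (s : S) (a : A) : 0 < policyOfSamples E η t x s a := by
  induction t generalizing s a with
  | zero =>
    have : (0 : ℝ) < Fintype.card A := by exact_mod_cast Fintype.card_pos
    simpa [policyOfSamples] using this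
  | succ t ih => exact expWeights_pos _ _ (ih _ s) a

theorem policyOfSamples_isPolicy [Nonempty A] (E : EvalOp S A) (η : ℝ) (t : ℕ)
    (x : Fin t → E.Sample) : IsPolicy (policyOfSamples E η t x) := by
  intro s
  cases t with
  | zero =>
    have : (0 : ℝ) < Fintype.card A := by exact_mod_cast Fintype.card_pos
    refine ⟨fun a => (policyOfSamples_pos E η 0 x s a).le, ?_⟩
    simp [policyOfSamples, this.ne']
  | succ t => exact expWeights_mem _ _ (policyOfSamples_pos E η t _ s)

variable [Fintype S] {Ω : Type*} [MeasurableSpace Ω]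

namespace IsSPMDRun

variable {E : EvalOp S A} {η : ℝ} {k : ℕ} {μ : Measure Ω} {ξ : ℕ → Ω → E.Sample}
  {π : ℕ → Ω → S → A → ℝ} {R : Ω → Fin k}

/-- The minimizer is unique, so the policies are deterministic functions of finitely many discrete
samples. Measurability and integrability follow from this. -/
theorem policy_eq [Nonempty A] (h : IsSPMDRun E η k μ ξ π R) {t : ℕ} (ht : t ≤ k) (ω : Ω) :
    π t ω = policyOfSamples E η t fun i => ξ i ω := by
  induction t with
  | zero =>
    ext s a
    exact h.init ω s a
  | succ t ih =>
    have ih := ih (Nat.le_of_succ_le ht)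
    ext1 s
    have h1 := h.step_min t ht ω s
    have h2 := h.step_mem t ht ω s
    rw [ih] at h1
    exact eq_expWeights_of_isMinOn h2 (policyOfSamples_pos E η t _ s) h1

theorem policy_succ [Nonempty A] (h : IsSPMDRun E η k μ ξ π R) {t : ℕ} (ht : t < k) (ω : Ω) (s : S) :
    π (t + 1) ω s = expWeights η (E.estimate (π t ω) (ξ t ω) s) (π t ω s) := by
  rw [h.policy_eq ht, h.policy_eq ht.le]
  rfl

theorem policy_pos [Nonempty A] (h : IsSPMDRun E η k μ ξ π R) {t : ℕ} (ht : t ≤ k) (ω : Ω)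
    (s : S) (a : A) : 0 < π t ω s a := by
  rw [h.policy_eq ht]
  exact policyOfSamples_pos E η t _ s a

theorem isPolicy [Nonempty A] (h : IsSPMDRun E η k μ ξ π R) {t : ℕ} (ht : t ≤ k) (ω : Ω) :
    IsPolicy (π t ω) := by
  rw [h.policy_eq ht]
  exact policyOfSamples_isPolicy E η t _

theorem measurable_past (h : IsSPMDRun E η k μ ξ π R) {t : ℕ} (ht : t ≤ k) :
    Measurable fun ω (i : Fin t) => ξ i ω :=
  measurable_pi_lambda _ fun i => h.measurable_sample i (i.2.trans_le ht)

theorem integrable_policy_sample [Nonempty A] [Finite E.Sample] [IsProbabilityMeasure μ]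
    (h : IsSPMDRun E η k μ ξ π R) {t : ℕ} (ht : t < k) (G : (S → A → ℝ) → E.Sample → ℝ) :
    Integrable (fun ω => G (π t ω) (ξ t ω)) μ := by
  simp only [h.policy_eq ht.le]
  exact integrable_of_finite_range ((h.measurable_past ht.le).prodMk (h.measurable_sample t ht))
    fun x => G (policyOfSamples E η t x.1) x.2

/-- Resampling: given the past, replacing the sample by a fresh one with the same initial states
changes no expectation. The sample itself serves as label of its initial states, so conditioning
reduces to finite sums. -/
theorem integral_eq_integral_startExp [Nonempty A] [Fintype E.Sample] [IsProbabilityMeasure μ]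
    (h : IsSPMDRun E η k μ ξ π R) {t : ℕ} (ht : t < k) (G : (S → A → ℝ) → E.Sample → ℝ) :
    ∫ ω, G (π t ω) (ξ t ω) ∂μ = ∫ ω, E.startExp (π t ω) (ξ t ω) (G (π t ω)) ∂μ := by
  classical
  have hX := (h.measurable_past ht.le).prodMk (h.measurable_sample t ht)
  simp only [h.policy_eq ht.le]
  rw [integral_eq_sum_of_finite_range hX fun x => G (policyOfSamples E η t x.1) x.2,
    integral_eq_sum_of_finite_range hX fun x => E.startExp (policyOfSamples E η t x.1) x.2
      (G (policyOfSamples E η t x.1)), Fintype.sum_prod_type, Fintype.sum_prod_type]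
  refine Finset.sum_congr rfl fun x _ => ?_
  set p := policyOfSamples E η t x with hp
  have hset : ∀ y, {ω | ((fun i : Fin t => ξ i ω), ξ t ω) = (x, y)} =
      {ω | (∀ i : Fin t, ξ i ω = x i) ∧ ξ t ω = y} := by
    intro y
    ext ω
    simp [funext_iff]
  have hlaw : ∀ y, μ.real {ω | ((fun i : Fin t => ξ i ω), ξ t ω) = (x, y)} =
      ∑ y₀, μ.real {ω | ((fun i : Fin t => ξ i ω), ξ t ω) = (x, y₀)} *
        if E.sameStart y₀ y then E.prob p y else 0 := by
    intro y
    have hm : MeasurableSet {ω | (∀ i : Fin t, ξ i ω = x i) ∧ E.sameStart (ξ t ω) y} := by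
      have : {ω | (∀ i : Fin t, ξ i ω = x i) ∧ E.sameStart (ξ t ω) y} =
          (fun ω => ((fun i : Fin t => ξ i ω), ξ t ω)) ⁻¹' {z | z.1 = x ∧ E.sameStart z.2 y} := by
        ext ω
        simp [funext_iff]
      rw [this]
      exact hX (Set.toFinite _).measurableSet
    rw [hset, h.law t ht x y, ← integral_indicator hm]
    -- On this event the policy equals `p`, so the integrand is a function of the past and the
    -- sample alone.
    have hF : ({ω | (∀ i : Fin t, ξ i ω = x i) ∧ E.sameStart (ξ t ω) y}.indicator
        fun ω => E.prob (π t ω) y) =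
        fun ω => (fun z : (Fin t → E.Sample) × E.Sample =>
          if z.1 = x then (if E.sameStart z.2 y then E.prob p y else 0) else 0)
            ((fun i : Fin t => ξ i ω), ξ t ω) := by
      ext ω
      simp only [Set.indicator_apply, Set.mem_ofPred_eq]
      by_cases h1 : (fun i : Fin t => ξ i ω) = x
      · have h2 : ∀ i : Fin t, ξ i ω = x i := fun i => congrFun h1 i
        rw [if_pos h1, h.policy_eq ht.le, h1, ← hp]
        simp [h2]
      · have h2 : ¬ ∀ i : Fin t, ξ i ω = x i := fun h2 => h1 (funext h2)
        simp [h1, h2]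
    rw [hF, integral_eq_sum_of_finite_range hX, Fintype.sum_prod_type, Finset.sum_eq_single x]
    · simp
    · intro b _ hb
      simp [hb]
    · simp
  have h1 : ∀ y, μ.real {ω | ((fun i : Fin t => ξ i ω), ξ t ω) = (x, y)} * G p y =
      ∑ y₀, μ.real {ω | ((fun i : Fin t => ξ i ω), ξ t ω) = (x, y₀)} *
        if E.sameStart y₀ y then E.prob p y * G p y else 0 := by
    intro y
    rw [hlaw y, Finset.sum_mul]
    refine Finset.sum_congr rfl fun y₀ _ => ?_
    split_ifs <;> ring
  simp only [EvalOp.startExp, Finset.mul_sum]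
  rw [Finset.sum_comm]
  exact Finset.sum_congr rfl fun y _ => h1 y

theorem integral_le [Nonempty A] [Fintype E.Sample] [IsProbabilityMeasure μ]
    (h : IsSPMDRun E η k μ ξ π R) {t : ℕ} (ht : t < k) (G : (S → A → ℝ) → E.Sample → ℝ) {B : ℝ}
    (hB : ∀ᵐ ω ∂μ, ∀ y₀, E.startExp (π t ω) y₀ (G (π t ω)) ≤ B) :
    ∫ ω, G (π t ω) (ξ t ω) ∂μ ≤ B := by
  rw [h.integral_eq_integral_startExp ht]
  calc ∫ ω, E.startExp (π t ω) (ξ t ω) (G (π t ω)) ∂μ ≤ ∫ _, B ∂μ := by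
        refine integral_mono_ae
          (h.integrable_policy_sample ht fun p y => E.startExp p y (G p)) (integrable_const B) ?_
        filter_upwards [hB] with ω hω using hω _
    _ = B := by simp

theorem integrable_output [Nonempty A] [Finite E.Sample] [IsProbabilityMeasure μ]
    (h : IsSPMDRun E η k μ ξ π R) (G : (S → A → ℝ) → ℝ) :
    Integrable (fun ω => G (π (R ω) ω)) μ := by
  simp only [h.policy_eq (R _).2.le]
  exact integrable_of_finite_range (h.measurable_index.prodMk (h.measurable_past le_rfl))
    fun x : Fin k × (Fin k → E.Sample) =>
      G (policyOfSamples E η x.1 fun i => x.2 (i.castLE x.1.2.le))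

theorem integral_output [Nonempty A] [Fintype E.Sample] [IsProbabilityMeasure μ]
    (h : IsSPMDRun E η k μ ξ π R) (G : (S → A → ℝ) → ℝ) :
    ∫ ω, G (π (R ω) ω) ∂μ = (1 / (k : ℝ)) * ∑ t ∈ Finset.range k, ∫ ω, G (π t ω) ∂μ := by
  have h1 := integral_uniform_index h.measurable_index (h.measurable_past le_rfl) h.index_uniform
    h.index_indep fun t x => G (policyOfSamples E η t fun i => x (i.castLE t.2.le))
  rw [← Fin.sum_univ_eq_sum_range (fun t => ∫ ω, G (π t ω) ∂μ)]
  have h2 : ∀ (t : Fin k) ω, π t ω =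
      policyOfSamples E η t fun i => ξ (i.castLE t.2.le : Fin k) ω := fun t ω =>
    h.policy_eq t.2.le ω
  simp only [h2]
  exact h1

/-- `mirror_regret` telescopes along each path: the first divergence, from the uniform policy, is at
most `log |A|`, and the last is nonnegative. -/
theorem sum_mirror_regret [Nonempty A] (h : IsSPMDRun E η k μ ξ π R) (hη : 0 ≤ η)
    (hE : ∀ p : S → A → ℝ, (∀ s a, 0 < p s a) → ∀ y s a, 0 ≤ E.estimate p y s a)
    (s : S) {p : A → ℝ} (hp : p ∈ stdSimplex ℝ A) (ω : Ω) :
    η * ∑ t ∈ Finset.range k, ∑ a, E.estimate (π t ω) (ξ t ω) s a * (π t ω s a - p a) ≤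
      Real.log (Fintype.card A) + η ^ 2 / 2 *
        ∑ t ∈ Finset.range k, ∑ a, π t ω s a * E.estimate (π t ω) (ξ t ω) s a ^ 2 := by
  have h1 : ∀ m ≤ k,
      η * ∑ t ∈ Finset.range m, ∑ a, E.estimate (π t ω) (ξ t ω) s a * (π t ω s a - p a) ≤
      Real.log (Fintype.card A) - klDivVec p (π m ω s) + η ^ 2 / 2 *
        ∑ t ∈ Finset.range m, ∑ a, π t ω s a * E.estimate (π t ω) (ξ t ω) s a ^ 2 := by
    intro m hm
    induction m with
    | zero =>
      have : π 0 ω s = fun _ => 1 / (Fintype.card A : ℝ) := funext fun a => h.init ω s a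
      have h2 := klDivVec_uniform_le hp
      rw [← this] at h2
      simpa using h2
    | succ m ih =>
      have h2 := ih (Nat.le_of_succ_le hm)
      have h3 := mirror_regret hη (hE (π m ω) (h.policy_pos (Nat.le_of_succ_le hm) ω) (ξ m ω) s) hp
        (h.isPolicy (Nat.le_of_succ_le hm) ω s) (h.policy_pos (Nat.le_of_succ_le hm) ω s)
      rw [← h.policy_succ hm] at h3
      rw [Finset.sum_range_succ, Finset.sum_range_succ, mul_add, mul_add]
      linarith
  have h2 := h1 k le_rfl
  have h3 := klDivVec_nonneg hp (h.isPolicy le_rfl ω s) (h.policy_pos le_rfl ω s)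
  linarith

end IsSPMDRun

end Run

/-! ### The expected optimality gap -/

section Gap

theorem vbeBias_nonneg {γ C ρ νlow : ℝ} (hγ0 : 0 < γ) (hγ1 : γ < 1)
    (hν1 : νlow ≤ 1) (n : ℕ) : 0 ≤ vbeBias γ C ρ νlow n := by
  have hm : (1 : ℝ) ≤ tMix C ρ νlow := by exact_mod_cast tMix_pos C ρ νlow
  have hx : νlow / (2 * tMix C ρ νlow) ≤ 1 := by
    rw [div_le_one (by positivity)]
    linarith
  have h1 : 0 < 1 - γ := by linarith
  have h2 : 0 ≤ (1 - νlow / (2 * tMix C ρ νlow)) ^ (n - 1) := pow_nonneg (by linarith) _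
  have h3 : 0 ≤ (1 - νlow / 2) ^ ⌈(n : ℝ) / tMix C ρ νlow⌉₊ := pow_nonneg (by linarith) _
  unfold vbeBias
  positivity

variable {S A Ω : Type*} [Fintype S] [Fintype A] [Nonempty A] [MeasurableSpace Ω]
  {μ : Measure Ω} [IsProbabilityMeasure μ] {V : VBEVariant} {M : MDP S A} {C ρ νlow : ℝ} {k n : ℕ}
  {ξ : ℕ → Ω → (vbe V M n).Sample} {π : ℕ → Ω → S → A → ℝ} {R : Ω → Fin k}

/-- The exact Q-function is the estimate plus its error: regret controls the former, the one-sided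
bias the latter. -/
theorem IsSPMDRun.sum_integral_inner_le {η : ℝ}
    (h : IsSPMDRun (vbe V M n) η k μ ξ π R) (hη : 0 ≤ η) (hn : 0 < n)
    (hC : 0 < C) (hρ : 0 < ρ) (hρ1 : ρ < 1) (hν : 0 < νlow)
    (hmix : ∀ i ≤ k, ∀ᵐ ω ∂μ, M.Mixes (π i ω) C ρ νlow) (s : S)
    {p : A → ℝ} (hp : p ∈ stdSimplex ℝ A) :
    η * ∑ t ∈ Finset.range k,
        ∫ ω, ∑ a, M.lookahead (M.value (π t ω)) s a * (π t ω s a - p a) ∂μ ≤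
      Real.log (Fintype.card A) + η ^ 2 / 2 * (k * (Fintype.card A * (1 / (1 - M.γ)) ^ 2)) +
        η * (k * vbeBias M.γ C ρ νlow n) := by
  have hbias : ∀ t ∈ Finset.range k,
      ∫ ω, ∑ a, (M.lookahead (M.value (π t ω)) s a -
        (vbe V M n).estimate (π t ω) (ξ t ω) s a) * (π t ω s a - p a) ∂μ ≤
        vbeBias M.γ C ρ νlow n := by
    intro t ht
    have ht := Finset.mem_range.1 ht
    refine h.integral_le ht (fun q y => ∑ a, (M.lookahead (M.value q) s a -
      (vbe V M n).estimate q y s a) * (q s a - p a)) ?_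
    filter_upwards [hmix t ht.le] with ω hω y₀
    exact startExp_vbe_inner_le V M hn (h.isPolicy ht.le ω) (h.policy_pos ht.le ω) hC hρ hρ1 hν hω
      y₀ s hp
  have hsq : ∀ t ∈ Finset.range k,
      ∫ ω, ∑ a, π t ω s a * (vbe V M n).estimate (π t ω) (ξ t ω) s a ^ 2 ∂μ ≤
        Fintype.card A * (1 / (1 - M.γ)) ^ 2 := by
    intro t ht
    have ht := Finset.mem_range.1 ht
    refine h.integral_le ht
      (fun q y => ∑ a, q s a * (vbe V M n).estimate q y s a ^ 2) (ae_of_all _ fun ω y₀ => ?_)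
    rw [EvalOp.startExp_sum]
    refine (Finset.sum_le_sum fun a _ => startExp_vbe_sq_le V M hn (h.isPolicy ht.le ω)
      (h.policy_pos ht.le ω) y₀ s a).trans_eq ?_
    simp
  have hi1 : ∀ t ∈ Finset.range k, Integrable (fun ω => ∑ a,
      (vbe V M n).estimate (π t ω) (ξ t ω) s a * (π t ω s a - p a)) μ := fun t ht =>
    h.integrable_policy_sample (Finset.mem_range.1 ht)
      fun q y => ∑ a, (vbe V M n).estimate q y s a * (q s a - p a)
  have hi2 : ∀ t ∈ Finset.range k, Integrable (fun ω => ∑ a,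
      π t ω s a * (vbe V M n).estimate (π t ω) (ξ t ω) s a ^ 2) μ := fun t ht =>
    h.integrable_policy_sample (Finset.mem_range.1 ht)
      fun q y => ∑ a, q s a * (vbe V M n).estimate q y s a ^ 2
  have hi3 : ∀ t ∈ Finset.range k, Integrable (fun ω => ∑ a, (M.lookahead (M.value (π t ω)) s a -
      (vbe V M n).estimate (π t ω) (ξ t ω) s a) * (π t ω s a - p a)) μ := fun t ht =>
    h.integrable_policy_sample (Finset.mem_range.1 ht)
      fun q y => ∑ a, (M.lookahead (M.value q) s a -
        (vbe V M n).estimate q y s a) * (q s a - p a)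
  have hreg : η * ∑ t ∈ Finset.range k,
      ∫ ω, ∑ a, (vbe V M n).estimate (π t ω) (ξ t ω) s a * (π t ω s a - p a) ∂μ ≤
      Real.log (Fintype.card A) + η ^ 2 / 2 * ∑ t ∈ Finset.range k,
        ∫ ω, ∑ a, π t ω s a * (vbe V M n).estimate (π t ω) (ξ t ω) s a ^ 2 ∂μ := by
    rw [← integral_finsetSum _ hi1, ← integral_finsetSum _ hi2, ← integral_const_mul,
      ← integral_const_mul]
    refine (integral_mono ((integrable_finsetSum _ hi1).const_mul η)
      ((integrable_const _).add ((integrable_finsetSum _ hi2).const_mul (η ^ 2 / 2)))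
      (h.sum_mirror_regret hη (fun q hq y => vbe_estimate_nonneg V M n hq y) s hp)).trans_eq ?_
    simp only [Pi.add_apply]
    rw [integral_add (integrable_const _) ((integrable_finsetSum _ hi2).const_mul _)]
    simp
  have hsplit : ∑ t ∈ Finset.range k,
        ∫ ω, ∑ a, M.lookahead (M.value (π t ω)) s a * (π t ω s a - p a) ∂μ =
      ∑ t ∈ Finset.range k,
        ∫ ω, ∑ a, (vbe V M n).estimate (π t ω) (ξ t ω) s a * (π t ω s a - p a) ∂μ +
      ∑ t ∈ Finset.range k, ∫ ω, ∑ a, (M.lookahead (M.value (π t ω)) s a -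
        (vbe V M n).estimate (π t ω) (ξ t ω) s a) * (π t ω s a - p a) ∂μ := by
    rw [← Finset.sum_add_distrib]
    refine Finset.sum_congr rfl fun t ht => ?_
    rw [← integral_add (hi1 t ht) (hi3 t ht)]
    refine integral_congr_ae (ae_of_all _ fun ω => ?_)
    simp only [← Finset.sum_add_distrib]
    exact Finset.sum_congr rfl fun a _ => by ring
  have h1 := Finset.sum_le_sum hbias
  have h2 := Finset.sum_le_sum hsq
  rw [Finset.sum_const, Finset.card_range, nsmul_eq_mul] at h1 h2
  have h3 := mul_le_mul_of_nonneg_left h1 hη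
  have h4 := mul_le_mul_of_nonneg_left h2 (show 0 ≤ η ^ 2 / 2 by positivity)
  rw [hsplit, mul_add]
  linarith

theorem IsSPMDRun.integral_inner_output_le
    (h : IsSPMDRun (vbe V M n) (spmdStep (Fintype.card A) M.γ k) k μ ξ π R) (hk : 0 < k)
    (hn : 0 < n) (hC : 0 < C) (hρ : 0 < ρ) (hρ1 : ρ < 1) (hν : 0 < νlow)
    (hmix : ∀ i ≤ k, ∀ᵐ ω ∂μ, M.Mixes (π i ω) C ρ νlow) (s : S)
    {p : A → ℝ} (hp : p ∈ stdSimplex ℝ A) :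
    ∫ ω, ∑ a, M.lookahead (M.value (π (R ω) ω)) s a * (π (R ω) ω s a - p a) ∂μ ≤
      Real.sqrt (2 * Fintype.card A * Real.log (Fintype.card A) / (k * (1 - M.γ) ^ 2)) +
        vbeBias M.γ C ρ νlow n := by
  have hγ := M.one_sub_γ_pos
  have hk' : (0 : ℝ) < k := by exact_mod_cast hk
  -- With one action the stepsize is `0` and cannot be divided by, but then there is only one
  -- policy.
  rcases (Nat.succ_le_of_lt (Fintype.card_pos (α := A))).eq_or_lt with hA | hA
  · have : Subsingleton A := Fintype.card_le_one_iff_subsingleton.1 hA.symm.le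
    have heq : ∀ q ∈ stdSimplex ℝ A, ∀ a, q a = 1 := by
      intro q hq a
      rw [← hq.2]
      exact (Fintype.sum_eq_single a fun b hb => absurd (Subsingleton.elim b a) hb).symm
    have hz : ∀ ω, ∑ a, M.lookahead (M.value (π (R ω) ω)) s a * (π (R ω) ω s a - p a) = 0 :=
      fun ω => Finset.sum_eq_zero fun a _ => by
        rw [heq _ (h.isPolicy (R ω).2.le ω s) a, heq p hp a, sub_self, mul_zero]
    obtain ⟨ω, hω⟩ := (hmix 0 hk.le).exists
    simp only [hz, integral_zero]
    exact add_nonneg (Real.sqrt_nonneg _)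
      (vbeBias_nonneg M.γ_pos M.γ_lt_one (hω.νlow_le_one s) n)
  · have hc : (1 : ℝ) < Fintype.card A := by exact_mod_cast hA
    have hL : 0 < Real.log (Fintype.card A) := Real.log_pos hc
    rw [h.integral_output fun q => ∑ a, M.lookahead (M.value q) s a * (q s a - p a)]
    have hη2 : spmdStep (Fintype.card A) M.γ k ^ 2 =
        2 * (1 - M.γ) ^ 2 * Real.log (Fintype.card A) / (k * Fintype.card A) :=
      Real.sq_sqrt (by positivity)
    have hη : 0 < spmdStep (Fintype.card A) M.γ k := Real.sqrt_pos.2 (by positivity)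
    have h1 := h.sum_integral_inner_le hη.le hn hC hρ hρ1 hν hmix s hp
    set η := spmdStep (Fintype.card A) M.γ k
    set L := Real.log (Fintype.card A)
    -- The stepsize balances the two parts of the regret: the quadratic term equals `log |A|` as
    -- well.
    have h2 : η ^ 2 / 2 * (k * (Fintype.card A * (1 / (1 - M.γ)) ^ 2)) = L := by
      rw [hη2]
      field_simp
    have h3 : Real.sqrt (2 * Fintype.card A * L / (k * (1 - M.γ) ^ 2)) = 2 * L / (η * k) := by
      rw [Real.sqrt_eq_iff_mul_self_eq (by positivity) (by positivity)]
      have : 2 * L / (η * k) * (2 * L / (η * k)) = 4 * L ^ 2 / (η ^ 2 * k ^ 2) := by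
        field_simp
        ring
      rw [this, hη2]
      field_simp
      ring
    rw [h2] at h1
    rw [h3]
    set T := ∑ t ∈ Finset.range k,
      ∫ ω, ∑ a, M.lookahead (M.value (π t ω)) s a * (π t ω s a - p a) ∂μ
    have h4 : T ≤ 2 * L / η + k * vbeBias M.γ C ρ νlow n := by
      rw [← sub_nonneg]
      have : 0 ≤ (L + L + η * (k * vbeBias M.γ C ρ νlow n) - η * T) / η :=
        div_nonneg (by linarith) hη.le
      refine this.trans_eq ?_
      field_simp
      ring
    calc 1 / (k : ℝ) * T ≤ 1 / (k : ℝ) * (2 * L / η + k * vbeBias M.γ C ρ νlow n) := by gcongr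
      _ = _ := by field_simp

theorem IsSPMDRun.integral_objective_sub_le
    (h : IsSPMDRun (vbe V M n) (spmdStep (Fintype.card A) M.γ k) k μ ξ π R) (hk : 0 < k)
    (hn : 0 < n) (hC : 0 < C) (hρ : 0 < ρ) (hρ1 : ρ < 1) (hν : 0 < νlow)
    (hmix : ∀ i ≤ k, ∀ᵐ ω ∂μ, M.Mixes (π i ω) C ρ νlow) {θ : S → ℝ} (hθ : θ ∈ stdSimplex ℝ S)
    {πstar : S → A → ℝ} (hstar : IsPolicy πstar) :
    ∫ ω, (M.objective θ (π (R ω) ω) - M.objective θ πstar) ∂μ ≤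
      Real.sqrt (2 * Fintype.card A * Real.log (Fintype.card A) / (k * (1 - M.γ) ^ 4)) +
        vbeBias M.γ C ρ νlow n / (1 - M.γ) := by
  have hγ := M.one_sub_γ_pos
  set B := Real.sqrt (2 * Fintype.card A * Real.log (Fintype.card A) / (k * (1 - M.γ) ^ 2)) +
    vbeBias M.γ C ρ νlow n with hB
  have hvalue : ∀ s, Integrable (fun ω => M.value (π (R ω) ω) s - M.value πstar s) μ := fun s =>
    h.integrable_output fun q => M.value q s - M.value πstar s
  have hD : ∀ s, ∫ ω, (M.value (π (R ω) ω) s - M.value πstar s) ∂μ ≤ B / (1 - M.γ) := by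
    -- The maximum principle is applied to the expected gap as a function of the state, not
    -- pathwise.
    refine M.le_of_le_add_stateKernel hstar fun s => ?_
    have h1 : ∀ ω, M.value (π (R ω) ω) s - M.value πstar s = _ := fun ω =>
      M.value_sub_value_eq (h.isPolicy (R ω).2.le ω) hstar s
    simp only [h1]
    rw [integral_add (h.integrable_output fun q =>
        ∑ a, M.lookahead (M.value q) s a * (q s a - πstar s a))
      ((integrable_finsetSum _ fun s' _ => (hvalue s').const_mul _).const_mul _),
      integral_const_mul, integral_finsetSum _ fun s' _ => (hvalue s').const_mul _]
    simp only [integral_const_mul]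
    gcongr
    exact h.integral_inner_output_le hk hn hC hρ hρ1 hν hmix s (hstar s)
  have h2 : ∀ ω, M.objective θ (π (R ω) ω) - M.objective θ πstar =
      ∑ s, θ s * (M.value (π (R ω) ω) s - M.value πstar s) := by
    intro ω
    simp only [MDP.objective, mul_sub, Finset.sum_sub_distrib]
  simp only [h2]
  rw [integral_finsetSum _ fun s _ => (hvalue s).const_mul _]
  simp only [integral_const_mul]
  refine (sum_mul_le_of_mem_stdSimplex hθ hD).trans_eq ?_
  rw [hB, add_div]
  congr 1
  rw [div_eq_iff hγ.ne', ← Real.sqrt_sq hγ.le, ← Real.sqrt_mul' _ (sq_nonneg _),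
    Real.sqrt_sq hγ.le]
  congr 1
  field_simp

end Gap

/-! ### Choice of the iteration count and the trajectory length -/

section SampleComplexity

/-- Both geometric rates, `γ` and `1 - νlow / (2 tMix)`, are at most `exp (-1 / (2L))`. -/
theorem vbeBias_le_exp {γ C ρ νlow : ℝ} (hγ0 : 0 < γ) (hγ1 : γ < 1) (hν : 0 < νlow)
    (hν1 : νlow ≤ 1) {L : ℝ} (hL : L = 1 / (1 - γ) + tMix C ρ νlow / νlow) (m : ℕ) :
    vbeBias γ C ρ νlow (m + 1) ≤ 16 * (m + 2) * Real.exp (-(m / (2 * L))) / (1 - γ) := by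
  have hm : (1 : ℝ) ≤ tMix C ρ νlow := by exact_mod_cast tMix_pos C ρ νlow
  have hg : 0 < 1 - γ := by linarith
  have hL1 : 1 / (1 - γ) ≤ L := by rw [hL]; exact le_add_of_nonneg_right (by positivity)
  have hL2 : tMix C ρ νlow / νlow ≤ L := by rw [hL]; exact le_add_of_nonneg_left (by positivity)
  have hL0 : 0 < L := lt_of_lt_of_le (by positivity) hL1
  set r := Real.exp (-(1 / (2 * L))) with hr
  have hr0 : 0 < r := Real.exp_pos _
  have hγr : γ ≤ r := by
    have h1 : 1 / (2 * L) ≤ 1 - γ := by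
      rw [div_le_iff₀ hg] at hL1
      rw [div_le_iff₀ (by positivity)]
      nlinarith
    have h2 := Real.add_one_le_exp (-(1 - γ))
    have h3 : Real.exp (-(1 - γ)) ≤ r := Real.exp_le_exp.2 (by linarith)
    linarith
  set q := 1 - νlow / (2 * tMix C ρ νlow) with hq
  have hqr : q ≤ r := by
    have h1 : 1 / (2 * L) ≤ νlow / (2 * tMix C ρ νlow) := by
      rw [div_le_iff₀ hν] at hL2
      rw [div_le_div_iff₀ (by positivity) (by positivity)]
      nlinarith
    have h2 := Real.add_one_le_exp (-(νlow / (2 * tMix C ρ νlow)))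
    have h3 : Real.exp (-(νlow / (2 * tMix C ρ νlow))) ≤ r := Real.exp_le_exp.2 (by linarith)
    linarith
  have hq0 : 0 ≤ q := by
    rw [hq, sub_nonneg, div_le_one (by positivity)]
    linarith
  have hq1 : q ≤ 1 := by
    rw [hq, sub_le_self_iff]
    positivity
  have h1 : γ ^ m ≤ r ^ m := pow_le_pow_left₀ hγ0.le hγr m
  have h2 : q ^ m ≤ r ^ m := pow_le_pow_left₀ hq0 hqr m
  have h3 : (1 - νlow / 2) ^ ⌈((m + 1 : ℕ) : ℝ) / tMix C ρ νlow⌉₊ ≤ r ^ m := by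
    refine (pow_ceil_div_le (by linarith) (by linarith) (tMix_pos C ρ νlow) (m + 1)).trans ?_
    rw [div_div, ← hq]
    exact (pow_le_pow_of_le_one hq0 hq1 (Nat.le_succ m)).trans h2
  have hrm : r ^ m = Real.exp (-(m / (2 * L))) := by
    rw [hr, ← Real.exp_nat_mul]
    congr 1
    ring
  rw [← hrm]
  have hrm0 : 0 < r ^ m := by positivity
  unfold vbeBias
  rw [Nat.add_sub_cancel, ← hq]
  calc _ ≤ 4 * (((m + 1 : ℕ) : ℝ) + 1) / (1 - γ) * (r ^ m + r ^ m) + 8 * r ^ m / (1 - γ) := by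
        gcongr
    _ = (8 * (m + 2) * r ^ m + 8 * r ^ m) / (1 - γ) := by push_cast; ring
    _ ≤ _ := by
        gcongr ?_ / _
        have : (0 : ℝ) ≤ m := m.cast_nonneg
        nlinarith [mul_nonneg this hrm0.le]

theorem vbeBias_div_le {γ ε C ρ νlow : ℝ} (hγ0 : 0 < γ) (hγ1 : γ < 1) (hε : 0 < ε)
    (hν : 0 < νlow) (hν1 : νlow ≤ 1) {L : ℝ} (hL : L = 1 / (1 - γ) + tMix C ρ νlow / νlow) {m : ℕ}
    (hm : 2 + 4 * L * (7 * Real.log 2 + 2 * Real.log L + Real.log (1 / ((1 - γ) * ε))) ≤ m) :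
    vbeBias γ C ρ νlow (m + 1) / (1 - γ) ≤ ε / 2 := by
  have hg : 0 < 1 - γ := by linarith
  have hL1 : 1 / (1 - γ) ≤ L := by rw [hL]; exact le_add_of_nonneg_right (by positivity)
  have hL0 : 0 < L := lt_of_lt_of_le (by positivity) hL1
  -- Half of the exponential decay is spent on absorbing the linear factor `m + 2`.
  have h1 : ((m : ℝ) + 2) ≤ 4 * L * Real.exp ((m + 2) / (4 * L)) := by
    have := Real.add_one_le_exp (((m : ℝ) + 2) / (4 * L))
    calc ((m : ℝ) + 2) = 4 * L * ((m + 2) / (4 * L)) := by field_simp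
      _ ≤ _ := by gcongr; linarith
  -- What is left is `exp (-(m - 2) / (4L))`, whence the summand `2` in `hm`. The `7 log 2` there is
  -- `log 128`, and `2 log L` pays for `L²`: one power for the factor `4L` just introduced, the
  -- other, with `1/L ≤ 1 - γ`, toward the two divisions by `1 - γ`.
  have h2 : Real.exp ((m + 2) / (4 * L)) * Real.exp (-(m / (2 * L))) ≤
      (1 - γ) * ε / (128 * L ^ 2) := by
    rw [← Real.exp_add, ← Real.le_log_iff_exp_le (by positivity), Real.log_div (by positivity)
      (by positivity), Real.log_mul (x := 128) (by norm_num) (by positivity), Real.log_pow,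
      show (128 : ℝ) = 2 ^ 7 by norm_num, Real.log_pow]
    rw [one_div, Real.log_inv] at hm
    have : (m + 2) / (4 * L) + -(m / (2 * L)) = -((m - 2) / (4 * L)) := by
      field_simp
      ring
    rw [this, neg_le, le_div_iff₀ (by positivity)]
    push_cast
    linarith
  have h3 : 16 * ((m : ℝ) + 2) * Real.exp (-(m / (2 * L))) ≤ (1 - γ) ^ 2 * ε / 2 := by
    calc 16 * ((m : ℝ) + 2) * Real.exp (-(m / (2 * L)))
        ≤ 16 * (4 * L * Real.exp ((m + 2) / (4 * L))) * Real.exp (-(m / (2 * L))) := by gcongr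
      _ = 64 * L * (Real.exp ((m + 2) / (4 * L)) * Real.exp (-(m / (2 * L)))) := by ring
      _ ≤ 64 * L * ((1 - γ) * ε / (128 * L ^ 2)) := by gcongr
      _ = (1 / L) * ((1 - γ) * ε / 2) := by field_simp; norm_num
      _ ≤ (1 - γ) * ((1 - γ) * ε / 2) := by
          gcongr
          rw [div_le_iff₀ hg] at hL1
          rw [div_le_iff₀ hL0]
          linarith
      _ = _ := by ring
  rw [div_le_iff₀ hg]
  refine (vbeBias_le_exp hγ0 hγ1 hν hν1 hL m).trans ?_
  rw [div_le_iff₀ hg]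
  linarith

theorem exists_iterations_and_length {cardA : ℕ} {γ ε C ρ νlow : ℝ} (hA : 2 ≤ cardA) (hγ0 : 0 < γ)
    (hγ1 : γ < 1) (hε : 0 < ε) (hε1 : ε ≤ 1 / (2 * (1 - γ))) (hν : 0 < νlow) (hν1 : νlow ≤ 1) :
    ∃ k n : ℕ, 0 < k ∧ 0 < n ∧
      (k : ℝ) * (2 * n + 1) ≤
        2080 * (cardA * Real.log cardA / (ε ^ 2 * (1 - γ) ^ 4) *
          (1 / (1 - γ) + tMix C ρ νlow / νlow) * Real.log (1 / ((1 - γ) * ε))) *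
          Real.log (1 / (1 - γ) + tMix C ρ νlow / νlow) ∧
      Real.sqrt (2 * cardA * Real.log cardA / (k * (1 - γ) ^ 4)) +
        vbeBias γ C ρ νlow n / (1 - γ) ≤ ε := by
  have hg : 0 < 1 - γ := by linarith
  have hm1 : (1 : ℝ) ≤ tMix C ρ νlow := by exact_mod_cast tMix_pos C ρ νlow
  have hlog2 : 0.69 < Real.log 2 := lt_trans (by norm_num) Real.log_two_gt_d9
  have hA' : (2 : ℝ) ≤ cardA := by exact_mod_cast hA
  have hlogA : Real.log 2 ≤ Real.log cardA := Real.log_le_log (by norm_num) hA'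
  obtain ⟨L, hL⟩ : ∃ L, L = 1 / (1 - γ) + tMix C ρ νlow / νlow := ⟨_, rfl⟩
  have hL2 : 2 ≤ L := by
    have h1 : 1 ≤ 1 / (1 - γ) := by rw [le_div_iff₀ hg]; linarith
    have h2 : 1 ≤ tMix C ρ νlow / νlow := by rw [le_div_iff₀ hν]; linarith
    linarith
  have hεg : (1 - γ) * ε ≤ 1 / 2 := by
    rw [le_div_iff₀ (by positivity)] at hε1
    linarith
  have ha : Real.log 2 ≤ Real.log (1 / ((1 - γ) * ε)) := by
    refine Real.log_le_log (by norm_num) ?_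
    rw [le_div_iff₀ (by positivity)]
    linarith
  have hb : Real.log 2 ≤ Real.log L := Real.log_le_log (by norm_num) hL2
  rw [← hL]
  obtain ⟨a, hadef⟩ : ∃ a, a = Real.log (1 / ((1 - γ) * ε)) := ⟨_, rfl⟩
  obtain ⟨b, hbdef⟩ : ∃ b, b = Real.log L := ⟨_, rfl⟩
  obtain ⟨X, hX⟩ : ∃ X, X = cardA * Real.log cardA / (ε ^ 2 * (1 - γ) ^ 4) := ⟨_, rfl⟩
  rw [← hadef] at ha
  rw [← hbdef] at hb
  rw [← hadef, ← hbdef, ← hX]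
  have hX1 : 1 ≤ X := by
    rw [hX, le_div_iff₀ (by positivity), one_mul]
    have h1 : ε ^ 2 * (1 - γ) ^ 4 = ((1 - γ) * ε) ^ 2 * (1 - γ) ^ 2 := by ring
    have h2 : ((1 - γ) * ε) ^ 2 ≤ (1 / 2) ^ 2 := by gcongr
    have h3 : (1 - γ) ^ 2 ≤ 1 := pow_le_one₀ hg.le (by linarith)
    rw [h1]
    nlinarith [sq_nonneg (1 - γ), sq_nonneg ((1 - γ) * ε)]
  have hab : 0.4761 ≤ a * b := by nlinarith
  have hLab : 0.95 ≤ L * a * b := by nlinarith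
  -- The factor `8` makes the square root at most `ε/2`. As `a` and `b` are at least `log 2`, the
  -- logarithms in `vbeBias_div_le` sum to at most `15ab`, and `4 · 15 = 60`. Rounding gives `k ≤
  -- 16X` and `2n + 1 ≤ 130 Lab`, hence `2080 = 16 · 130`.
  refine ⟨⌈8 * X⌉₊, ⌈2 + 60 * (L * a * b)⌉₊ + 1, Nat.ceil_pos.2 (by linarith), Nat.succ_pos _, ?_, ?_⟩
  · have h1 : (⌈8 * X⌉₊ : ℝ) ≤ 16 * X := by
      have := Nat.ceil_lt_add_one (show 0 ≤ 8 * X by linarith)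
      linarith
    have h2 : 2 * ((⌈2 + 60 * (L * a * b)⌉₊ + 1 : ℕ) : ℝ) + 1 ≤ 130 * (L * a * b) := by
      have := Nat.ceil_lt_add_one (show 0 ≤ 2 + 60 * (L * a * b) by linarith)
      push_cast
      linarith
    calc _ ≤ 16 * X * (130 * (L * a * b)) := by gcongr
      _ = _ := by ring
  · have h1 : Real.sqrt (2 * cardA * Real.log cardA / (⌈8 * X⌉₊ * (1 - γ) ^ 4)) ≤ ε / 2 := by
      rw [Real.sqrt_le_left (by positivity)]
      have hk : 8 * X ≤ (⌈8 * X⌉₊ : ℝ) := Nat.le_ceil _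
      have hk0 : (0 : ℝ) < (⌈8 * X⌉₊ : ℝ) := by linarith
      rw [div_le_iff₀ (by positivity)]
      have h2 : cardA * Real.log cardA = X * (ε ^ 2 * (1 - γ) ^ 4) := by
        rw [hX]
        field_simp
      calc 2 * cardA * Real.log cardA = 8 * X * (ε ^ 2 * (1 - γ) ^ 4 / 4) := by
            rw [mul_assoc, h2]; ring
        _ ≤ (⌈8 * X⌉₊ : ℝ) * (ε ^ 2 * (1 - γ) ^ 4 / 4) := by gcongr
        _ = _ := by ring
    have h2 : vbeBias γ C ρ νlow (⌈2 + 60 * (L * a * b)⌉₊ + 1) / (1 - γ) ≤ ε / 2 := by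
      refine vbeBias_div_le hγ0 hγ1 hε hν hν1 hL (le_trans ?_ (Nat.le_ceil _))
      rw [← hadef, ← hbdef]
      have h3 : 7 * Real.log 2 + 2 * b + a ≤ 15 * (a * b) := by nlinarith
      nlinarith
    linarith

end SampleComplexity

theorem mainTheorem2 :
    -- the bound on the expected optimality gap
    (∀ (V : VBEVariant) (S : Type u) (A : Type v) (Ω : Type w) [Fintype S] [Fintype A] [Nonempty A]
      [MeasurableSpace Ω] (μ : Measure Ω) [IsProbabilityMeasure μ]
      (M : MDP S A) (C ρ νlow : ℝ) (k n : ℕ)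
      (ξ : ℕ → Ω → (vbe V M n).Sample) (π : ℕ → Ω → S → A → ℝ) (R : Ω → Fin k)
      (θ : S → ℝ) (πstar : S → A → ℝ),
      0 < C → 0 < ρ → ρ < 1 → 0 < νlow → 0 < k → 0 < n →
      IsSPMDRun (vbe V M n) (spmdStep (Fintype.card A) M.γ k) k μ ξ π R →
      (∀ i ≤ k, ∀ᵐ ω ∂μ, M.Mixes (π i ω) C ρ νlow) →
      θ ∈ stdSimplex ℝ S → M.IsOptimal πstar →
      Integrable (fun ω => M.objective θ (π (R ω) ω) - M.objective θ πstar) μ ∧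
      ∫ ω, (M.objective θ (π (R ω) ω) - M.objective θ πstar) ∂μ ≤
        Real.sqrt (2 * Fintype.card A * Real.log (Fintype.card A) / (k * (1 - M.γ) ^ 4)) +
          vbeBias M.γ C ρ νlow n / (1 - M.γ)) ∧
    -- the sample complexity, with an absolute constant `K`
    (∃ K : ℝ, 0 < K ∧
      ∀ (cardA : ℕ) (γ ε C ρ νlow : ℝ),
        2 ≤ cardA → 0 < γ → γ < 1 → 0 < ε → ε ≤ 1 / (2 * (1 - γ)) →
        0 < C → 0 < ρ → ρ < 1 → 0 < νlow → νlow ≤ 1 →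
        ∃ k n : ℕ, 0 < k ∧ 0 < n ∧
          ∀ (V : VBEVariant) (S : Type u) (A : Type v) [Fintype S] [Fintype A] (M : MDP S A),
            Fintype.card A = cardA → M.γ = γ →
            ((k * (vbe V M n).size : ℕ) : ℝ) ≤
              K * (cardA * Real.log cardA / (ε ^ 2 * (1 - γ) ^ 4) *
                (1 / (1 - γ) + tMix C ρ νlow / νlow) * Real.log (1 / ((1 - γ) * ε))) *
                Real.log (1 / (1 - γ) + tMix C ρ νlow / νlow) ∧
            ∀ (Ω : Type w) [MeasurableSpace Ω] (μ : Measure Ω) [IsProbabilityMeasure μ]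
              (ξ : ℕ → Ω → (vbe V M n).Sample) (π : ℕ → Ω → S → A → ℝ) (R : Ω → Fin k),
              IsSPMDRun (vbe V M n) (spmdStep cardA γ k) k μ ξ π R →
              (∀ i ≤ k, ∀ᵐ ω ∂μ, M.Mixes (π i ω) C ρ νlow) →
              ∀ (θ : S → ℝ) (πstar : S → A → ℝ), θ ∈ stdSimplex ℝ S → M.IsOptimal πstar →
                ∫ ω, (M.objective θ (π (R ω) ω) - M.objective θ πstar) ∂μ ≤ ε) := by
  refine ⟨?_, 2080, by norm_num, ?_⟩
  · intro V S A Ω _ _ _ _ μ _ M C ρ νlow k n ξ π R θ πstar hC hρ hρ1 hν hk hn h hmix hθ hstar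
    exact ⟨h.integrable_output fun q => M.objective θ q - M.objective θ πstar,
      h.integral_objective_sub_le hk hn hC hρ hρ1 hν hmix hθ hstar.1⟩
  · intro cardA γ ε C ρ νlow hA hγ0 hγ1 hε hε1 hC hρ hρ1 hν hν1
    obtain ⟨k, n, hk, hn, hsize, hgap⟩ :=
      exists_iterations_and_length (C := C) (ρ := ρ) hA hγ0 hγ1 hε hε1 hν hν1
    refine ⟨k, n, hk, hn, fun V S A _ _ M hcard hγ => ⟨le_trans ?_ hsize, ?_⟩⟩
    -- VBE-I uses the most pairs, so one choice of `k` and `n` serves both variants.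
    · have h1 : (vbe V M n).size ≤ 2 * n + 1 := by
        cases V
        · exact le_of_eq (by change n + (n + 1) = _; omega)
        · change n + 1 ≤ _
          omega
      exact_mod_cast Nat.mul_le_mul_left k h1
    · intro Ω _ μ _ ξ π R h hmix θ πstar hθ hstar
      subst hcard hγ
      have : Nonempty A := Fintype.card_pos_iff.1 (by omega)
      exact (h.integral_objective_sub_le hk hn hC hρ hρ1 hν hmix hθ hstar.1).trans hgap
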